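/- All derivatives below are weak derivatives of real functions on $\mathbf{R}^3$, and functions that agree almost everywhere are identified. Let $$BL(\mathbf{R}^3)=\{u\in H^1_{loc}(\mathbf{R}^3):\ \nabla u\in L_2(\mathbf{R}^3)^3\},\qquad \dot{BL}(\mathbf{R}^3)=BL(\mathbf{R}^3)/\mathbf{R},$$ $$BL^2(\mathbf{R}^3)=\{\varphi\in L_{2,loc}(\mathbf{R}^3):\ \partial^2_{x_ix_j}\varphi\in L_2(\mathbf{R}^3),\ i,j\in\{1,2,3\}\},\qquad \dot{BL}^2(\mathbf{R}^3)=BL^2(\mathbf{R}^3)/P,$$ where $/\mathbf{R}$ means modulo constant functions and $P=\{x\mapsto b+a\cdot x:\ b\in\mathbf{R},\ a\in\mathbf{R}^3\}$. The space $\dot{BL}(\mathbf{R}^3)^3$ carries the norm $\|[u]\|=\|\nabla u\|_{L_2(\mathbf{R}^3)^{3\times 3}}$. Let $\dot{BLC}(\mathbf{R}^3)\subset\dot{BL}(\mathbf{R}^3)^3$ be the completion, modulo constants, of $\{\psi\in C_c^\infty(\mathbf{R}^3)^3:\ \operatorname{div}\psi=0\}$ with respect to $|\psi|_{H(\mathbf{R}^3,\operatorname{curl})}=\|\operatorname{curl}\psi\|_{L_2(\mathbf{R}^3)^3}$,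 realized in $\dot{BL}(\mathbf{R}^3)^3$; that is, the set of all limits in $\dot{BL}(\mathbf{R}^3)^3$ of sequences of divergence free fields in $C_c^\infty(\mathbf{R}^3)^3$ that are Cauchy with respect to $|\cdot|_{H(\mathbf{R}^3,\operatorname{curl})}$. The gradient is a well-defined map $\nabla:\dot{BL}^2(\mathbf{R}^3)\to\dot{BL}(\mathbf{R}^3)^3$. For every $u\in\dot{BL}(\mathbf{R}^3)^3$ there are $\varphi\in\dot{BL}^2(\mathbf{R}^3)$ and $u^*\in\dot{BL}(\mathbf{R}^3)^3$ with $\operatorname{div}(u^*)=0$ such that $$u=\nabla\varphi+u^*\quad\text{in }\dot{BL}(\mathbf{R}^3)^3.$$ In fact, there is the direct sum $$\dot{BL}(\mathbf{R}^3)^3=\nabla\bigl(\dot{BL}^2(\mathbf{R}^3)\bigr)\oplus\dot{BLC}(\mathbf{R}^3).$$ -/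

import Mathlib

open MeasureTheory Filter Topology
open scoped ContDiff ENNReal

namespace BeppoLevi

/-- Euclidean three-space. -/
abbrev E3 : Type := EuclideanSpace ℝ (Fin 3)

/-- The classical partial derivative `∂ᵢψ`. -/
noncomputable def pd (i : Fin 3) (ψ : E3 → ℝ) (x : E3) : ℝ :=
  fderiv ℝ ψ x (EuclideanSpace.single i 1)

/-- Membership in `C_c^∞(ℝ³)`. -/
def IsTest (ψ : E3 → ℝ) : Prop := ContDiff ℝ ∞ ψ ∧ HasCompactSupport ψ

/-- Membership in `L_{2,loc}(ℝ³)`. -/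
def MemL2loc (f : E3 → ℝ) : Prop :=
  ∀ K : Set E3, IsCompact K → MemLp f 2 (volume.restrict K)

/-- `g` is the weak partial derivative `∂ᵢf`. -/
def HasWeakDeriv (i : Fin 3) (f g : E3 → ℝ) : Prop :=
  LocallyIntegrable f ∧ LocallyIntegrable g ∧
    ∀ ψ : E3 → ℝ, IsTest ψ → ∫ x, f x * pd i ψ x = -∫ x, g x * ψ x

/-- `g` is the weak second partial derivative `∂²f / ∂xᵢ∂xⱼ`
(no first derivatives of `f` are presupposed). -/
def HasWeakDeriv2 (i j : Fin 3) (f g : E3 → ℝ) : Prop :=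
  LocallyIntegrable f ∧ LocallyIntegrable g ∧
    ∀ ψ : E3 → ℝ, IsTest ψ → ∫ x, f x * pd i (pd j ψ) x = ∫ x, g x * ψ x

theorem IsTest.pd {ψ : E3 → ℝ} (h : IsTest ψ) (i : Fin 3) : IsTest (pd i ψ) := by
  refine ⟨?_, ?_⟩
  · exact (h.1.fderiv_right (m := ∞) (by simp)).clm_apply contDiff_const
  · exact h.2.fderiv_apply (𝕜 := ℝ) (EuclideanSpace.single i 1)

theorem pd_add {f g : E3 → ℝ} (hf : IsTest f) (hg : IsTest g) (i : Fin 3) :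
    pd i (f + g) = pd i f + pd i g := by
  funext x
  have h1 : DifferentiableAt ℝ f x := hf.1.differentiable (by simp) x
  have h2 : DifferentiableAt ℝ g x := hg.1.differentiable (by simp) x
  simp [pd, fderiv_add h1 h2]

theorem pd_smul {f : E3 → ℝ} (c : ℝ) (hf : IsTest f) (i : Fin 3) :
    pd i (c • f) = c • pd i f := by
  funext x
  have h1 : DifferentiableAt ℝ f x := hf.1.differentiable (by simp) x
  simp [pd, fderiv_const_smul h1 c]

theorem IsTest.zero : IsTest 0 := ⟨contDiff_const, HasCompactSupport.zero⟩

theorem IsTest.add {f g : E3 → ℝ} (hf : IsTest f) (hg : IsTest g) : IsTest (f + g) :=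
  ⟨hf.1.add hg.1, hf.2.add hg.2⟩

theorem IsTest.smul {f : E3 → ℝ} (c : ℝ) (hf : IsTest f) : IsTest (c • f) := by
  refine ⟨hf.1.const_smul c, ?_⟩
  have h : HasCompactSupport ((fun _ : E3 => c) • f) := hf.2.smul_left
  exact h

theorem integrable_mul_test {f ψ : E3 → ℝ} (hf : LocallyIntegrable f) (hψ : IsTest ψ) :
    Integrable (fun x => f x * ψ x) := by
  have := hf.integrable_smul_right_of_hasCompactSupport hψ.1.continuous hψ.2
  simpa using this

theorem MemL2loc.add {f g : E3 → ℝ} (hf : MemL2loc f) (hg : MemL2loc g) : MemL2loc (f + g) :=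
  fun K hK => (hf K hK).add (hg K hK)

theorem MemL2loc.smul {f : E3 → ℝ} (c : ℝ) (hf : MemL2loc f) : MemL2loc (c • f) :=
  fun K hK => (hf K hK).const_smul c

theorem MemL2loc.zero : MemL2loc 0 := fun _ _ => MemLp.zero

theorem HasWeakDeriv.add {i : Fin 3} {f g f' g' : E3 → ℝ} (h : HasWeakDeriv i f g)
    (h' : HasWeakDeriv i f' g') : HasWeakDeriv i (f + f') (g + g') := by
  refine ⟨h.1.add h'.1, h.2.1.add h'.2.1, fun ψ hψ => ?_⟩
  simp only [Pi.add_apply, add_mul]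
  rw [integral_add (integrable_mul_test h.1 (hψ.pd i)) (integrable_mul_test h'.1 (hψ.pd i)),
    integral_add (integrable_mul_test h.2.1 hψ) (integrable_mul_test h'.2.1 hψ),
    h.2.2 ψ hψ, h'.2.2 ψ hψ]
  ring

theorem HasWeakDeriv.smul {i : Fin 3} {f g : E3 → ℝ} (c : ℝ) (h : HasWeakDeriv i f g) :
    HasWeakDeriv i (c • f) (c • g) := by
  refine ⟨h.1.smul c, h.2.1.smul c, fun ψ hψ => ?_⟩
  simp only [Pi.smul_apply, smul_eq_mul, mul_assoc, integral_const_mul]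
  rw [h.2.2 ψ hψ]
  ring

theorem HasWeakDeriv.zero (i : Fin 3) : HasWeakDeriv i 0 0 :=
  ⟨locallyIntegrable_zero, locallyIntegrable_zero, fun ψ _ => by simp⟩

theorem HasWeakDeriv2.add {i j : Fin 3} {f g f' g' : E3 → ℝ} (h : HasWeakDeriv2 i j f g)
    (h' : HasWeakDeriv2 i j f' g') : HasWeakDeriv2 i j (f + f') (g + g') := by
  refine ⟨h.1.add h'.1, h.2.1.add h'.2.1, fun ψ hψ => ?_⟩
  simp only [Pi.add_apply, add_mul]
  rw [integral_add (integrable_mul_test h.1 ((hψ.pd j).pd i))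
      (integrable_mul_test h'.1 ((hψ.pd j).pd i)),
    integral_add (integrable_mul_test h.2.1 hψ) (integrable_mul_test h'.2.1 hψ),
    h.2.2 ψ hψ, h'.2.2 ψ hψ]

theorem HasWeakDeriv2.smul {i j : Fin 3} {f g : E3 → ℝ} (c : ℝ) (h : HasWeakDeriv2 i j f g) :
    HasWeakDeriv2 i j (c • f) (c • g) := by
  refine ⟨h.1.smul c, h.2.1.smul c, fun ψ hψ => ?_⟩
  simp only [Pi.smul_apply, smul_eq_mul, mul_assoc, integral_const_mul]
  rw [h.2.2 ψ hψ]

theorem HasWeakDeriv2.zero (i j : Fin 3) : HasWeakDeriv2 i j 0 0 :=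
  ⟨locallyIntegrable_zero, locallyIntegrable_zero, fun ψ _ => by simp⟩

/-- `BL(ℝ³)`: functions in `L_{2,loc}` whose weak gradient exists and lies in `L₂`
(such a function is automatically in `H¹_loc`). Functions that agree almost everywhere
are identified in the quotient `BLdot` below. -/
noncomputable def BL : Submodule ℝ (E3 → ℝ) where
  carrier := {f | MemL2loc f ∧ ∀ i, ∃ g, MemLp g 2 volume ∧ HasWeakDeriv i f g}
  zero_mem' := ⟨MemL2loc.zero, fun i => ⟨0, MemLp.zero, HasWeakDeriv.zero i⟩⟩
  add_mem' := by
    rintro f f' ⟨h1, h2⟩ ⟨h1', h2'⟩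
    refine ⟨h1.add h1', fun i => ?_⟩
    obtain ⟨g, hg, hw⟩ := h2 i
    obtain ⟨g', hg', hw'⟩ := h2' i
    exact ⟨g + g', hg.add hg', hw.add hw'⟩
  smul_mem' := by
    rintro c f ⟨h1, h2⟩
    refine ⟨h1.smul c, fun i => ?_⟩
    obtain ⟨g, hg, hw⟩ := h2 i
    exact ⟨c • g, hg.const_smul c, hw.smul c⟩

/-- `BL²(ℝ³)`: functions in `L_{2,loc}` all of whose weak second derivatives lie in `L₂`. -/
noncomputable def BL2 : Submodule ℝ (E3 → ℝ) where
  carrier := {f | MemL2loc f ∧ ∀ i j, ∃ g, MemLp g 2 volume ∧ HasWeakDeriv2 i j f g}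
  zero_mem' := ⟨MemL2loc.zero, fun i j => ⟨0, MemLp.zero, HasWeakDeriv2.zero i j⟩⟩
  add_mem' := by
    rintro f f' ⟨h1, h2⟩ ⟨h1', h2'⟩
    refine ⟨h1.add h1', fun i j => ?_⟩
    obtain ⟨g, hg, hw⟩ := h2 i j
    obtain ⟨g', hg', hw'⟩ := h2' i j
    exact ⟨g + g', hg.add hg', hw.add hw'⟩
  smul_mem' := by
    rintro c f ⟨h1, h2⟩
    refine ⟨h1.smul c, fun i j => ?_⟩
    obtain ⟨g, hg, hw⟩ := h2 i j
    exact ⟨c • g, hg.const_smul c, hw.smul c⟩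

/-- Functions that are almost everywhere equal to a constant. -/
def aeConst : Submodule ℝ (E3 → ℝ) where
  carrier := {f | ∃ c : ℝ, ∀ᵐ x, f x = c}
  zero_mem' := ⟨0, by simp⟩
  add_mem' := by
    rintro f g ⟨a, ha⟩ ⟨b, hb⟩
    refine ⟨a + b, ?_⟩
    filter_upwards [ha, hb] with x hx hy
    simp [hx, hy]
  smul_mem' := by
    rintro c f ⟨a, ha⟩
    refine ⟨c * a, ?_⟩
    filter_upwards [ha] with x hx
    simp [hx]

/-- Functions that are almost everywhere equal to an affine function `x ↦ b + a · x`. -/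
def aeAffine : Submodule ℝ (E3 → ℝ) where
  carrier := {f | ∃ (b : ℝ) (a : E3), ∀ᵐ x, f x = b + inner ℝ a x}
  zero_mem' := ⟨0, 0, by simp⟩
  add_mem' := by
    rintro f g ⟨b, a, ha⟩ ⟨b', a', hb⟩
    refine ⟨b + b', a + a', ?_⟩
    filter_upwards [ha, hb] with x hx hy
    simp only [Pi.add_apply, hx, hy, inner_add_left]
    ring
  smul_mem' := by
    rintro c f ⟨b, a, ha⟩
    refine ⟨c * b, c • a, ?_⟩
    filter_upwards [ha] with x hx
    simp only [Pi.smul_apply, hx, smul_eq_mul, real_inner_smul_left]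
    ring

/-- The homogeneous Beppo-Levi space `BL(ℝ³)/ℝ`. -/
abbrev BLdot : Type := ↥BL ⧸ aeConst.submoduleOf BL

/-- The second order Beppo-Levi space `BL²(ℝ³)/P`, with `P` the affine functions. -/
abbrev BL2dot : Type := ↥BL2 ⧸ aeAffine.submoduleOf BL2

/-- `BL(ℝ³)³` modulo constants. -/
abbrev BLdot3 : Type := Fin 3 → BLdot

/-- The vector field `v ∈ BL(ℝ³)³` is a representative of the class `U`. -/
def Represents (v : Fin 3 → BL) (U : BLdot3) : Prop :=
  ∀ i, Submodule.Quotient.mk (v i) = U i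

theorem Represents.add {v w : Fin 3 → BL} {U V : BLdot3} (hv : Represents v U)
    (hw : Represents w V) : Represents (v + w) (U + V) := fun i => by
  simp [← hv i, ← hw i]

theorem Represents.smul {v : Fin 3 → BL} {U : BLdot3} (c : ℝ) (hv : Represents v U) :
    Represents (c • v) (c • U) := fun i => by
  simp [← hv i]

theorem Represents.zero : Represents 0 0 := fun i => by simp

/-- `G = ∇Φ`: some representative of `G` is the weak gradient of some representative of `Φ`. -/
def IsGrad (Φ : BL2dot) (G : BLdot3) : Prop :=
  ∃ (φ : BL2) (v : Fin 3 → BL), Submodule.Quotient.mk φ = Φ ∧ Represents v G ∧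
    ∀ i, HasWeakDeriv i (φ : E3 → ℝ) (v i : E3 → ℝ)

/-- `div U = 0` in the sense of distributions (this does not depend on the representative). -/
def DivFree (U : BLdot3) : Prop :=
  ∃ v : Fin 3 → BL, Represents v U ∧
    ∀ ψ : E3 → ℝ, IsTest ψ → ∑ i, ∫ x, (v i : E3 → ℝ) x * pd i ψ x = 0

/-- The space `∇(BL²(ℝ³)/P)` as a subspace of `BL(ℝ³)³` modulo constants. -/
noncomputable def gradBL2 : Submodule ℝ BLdot3 where
  carrier := {G | ∃ Φ : BL2dot, IsGrad Φ G}
  zero_mem' := ⟨0, 0, 0, by simp, Represents.zero, fun i => HasWeakDeriv.zero i⟩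
  add_mem' := by
    rintro G G' ⟨Φ, φ, v, h1, h2, h3⟩ ⟨Φ', φ', v', h1', h2', h3'⟩
    exact ⟨Φ + Φ', φ + φ', v + v', by simp [h1, h1'], h2.add h2', fun i => (h3 i).add (h3' i)⟩
  smul_mem' := by
    rintro c G ⟨Φ, φ, v, h1, h2, h3⟩
    exact ⟨c • Φ, c • φ, c • v, by simp [h1], h2.smul c, fun i => (h3 i).smul c⟩

/-- Membership in `{ψ ∈ C_c^∞(ℝ³)³ : div ψ = 0}`. -/
def IsSolenoidalTest (ψ : Fin 3 → E3 → ℝ) : Prop :=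
  (∀ i, IsTest (ψ i)) ∧ ∀ x, ∑ i, pd i (ψ i) x = 0

/-- The curl of a smooth vector field, with values in Euclidean three-space. -/
noncomputable def curl (ψ : Fin 3 → E3 → ℝ) (x : E3) : E3 :=
  !₂[pd 1 (ψ 2) x - pd 2 (ψ 1) x, pd 2 (ψ 0) x - pd 0 (ψ 2) x, pd 0 (ψ 1) x - pd 1 (ψ 0) x]

/-- `|ψ|_{H(ℝ³,curl)} = ‖curl ψ‖_{L₂}`. -/
noncomputable def curlNorm (ψ : Fin 3 → E3 → ℝ) : ℝ≥0∞ := eLpNorm (curl ψ) 2 volume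

/-- The sequence `ψ` is Cauchy with respect to `|·|_{H(ℝ³,curl)}`. -/
def CurlCauchy (ψ : ℕ → Fin 3 → E3 → ℝ) : Prop :=
  Tendsto (fun p : ℕ × ℕ => curlNorm (ψ p.1 - ψ p.2)) atTop (𝓝 0)

/-- Convergence of a sequence of test fields to `U` in `BL(ℝ³)³` modulo constants, that is,
in the norm `‖[u]‖ = ‖∇u‖_{L₂}`. -/
def TendstoBL (ψ : ℕ → Fin 3 → E3 → ℝ) (U : BLdot3) : Prop :=
  ∃ (v : Fin 3 → BL) (D : Fin 3 → Fin 3 → E3 → ℝ), Represents v U ∧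
    ∀ i j, MemLp (D i j) 2 volume ∧ HasWeakDeriv j (v i : E3 → ℝ) (D i j) ∧
      Tendsto (fun n => eLpNorm (pd j (ψ n i) - D i j) 2 volume) atTop (𝓝 0)

theorem IsSolenoidalTest.zero : IsSolenoidalTest 0 :=
  ⟨fun _ => IsTest.zero, fun x => by simp [pd]⟩

theorem IsSolenoidalTest.add {f g : Fin 3 → E3 → ℝ} (hf : IsSolenoidalTest f)
    (hg : IsSolenoidalTest g) : IsSolenoidalTest (f + g) := by
  refine ⟨fun i => (hf.1 i).add (hg.1 i), fun x => ?_⟩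
  simp only [Pi.add_apply, pd_add (hf.1 _) (hg.1 _), Finset.sum_add_distrib, hf.2 x, hg.2 x,
    add_zero]

theorem IsSolenoidalTest.smul {f : Fin 3 → E3 → ℝ} (c : ℝ) (hf : IsSolenoidalTest f) :
    IsSolenoidalTest (c • f) := by
  refine ⟨fun i => (hf.1 i).smul c, fun x => ?_⟩
  simp only [Pi.smul_apply, pd_smul c (hf.1 _), smul_eq_mul, ← Finset.mul_sum, hf.2 x, mul_zero]

theorem curl_add {f g : Fin 3 → E3 → ℝ} (hf : ∀ i, IsTest (f i)) (hg : ∀ i, IsTest (g i)) :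
    curl (f + g) = curl f + curl g := by
  funext x
  ext k
  fin_cases k <;> simp [curl, pd_add (hf _) (hg _)] <;> ring

theorem curl_smul {f : Fin 3 → E3 → ℝ} (c : ℝ) (hf : ∀ i, IsTest (f i)) :
    curl (c • f) = c • curl f := by
  funext x
  ext k
  fin_cases k <;> simp [curl, pd_smul c (hf _)] <;> ring

theorem continuous_curl {f : Fin 3 → E3 → ℝ} (hf : ∀ i, IsTest (f i)) : Continuous (curl f) := by
  have h : ∀ i j, Continuous (pd i (f j)) := fun i j => ((hf j).pd i).1.continuous
  refine (PiLp.continuous_toLp 2 _).comp (continuous_pi fun k => ?_)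
  fin_cases k
  · exact (h 1 2).sub (h 2 1)
  · exact (h 2 0).sub (h 0 2)
  · exact (h 0 1).sub (h 1 0)

theorem IsTest.sub {f g : E3 → ℝ} (hf : IsTest f) (hg : IsTest g) : IsTest (f - g) :=
  ⟨hf.1.sub hg.1, hf.2.sub hg.2⟩

theorem CurlCauchy.add {f g : ℕ → Fin 3 → E3 → ℝ} (hf : ∀ n i, IsTest (f n i))
    (hg : ∀ n i, IsTest (g n i)) (cf : CurlCauchy f) (cg : CurlCauchy g) :
    CurlCauchy (f + g) := by
  have h0 := Filter.Tendsto.add cf cg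
  rw [add_zero] at h0
  refine tendsto_of_tendsto_of_tendsto_of_le_of_le tendsto_const_nhds h0 (fun _ => bot_le) ?_
  intro p
  have hf' : ∀ i, IsTest ((f p.1 - f p.2) i) := fun i => (hf _ i).sub (hf _ i)
  have hg' : ∀ i, IsTest ((g p.1 - g p.2) i) := fun i => (hg _ i).sub (hg _ i)
  have e : (f + g) p.1 - (f + g) p.2 = (f p.1 - f p.2) + (g p.1 - g p.2) := by
    simp only [Pi.add_apply]; abel
  simp only [e, curlNorm, curl_add hf' hg']
  exact eLpNorm_add_le (continuous_curl hf').aestronglyMeasurable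
    (continuous_curl hg').aestronglyMeasurable (by norm_num)

theorem CurlCauchy.smul {f : ℕ → Fin 3 → E3 → ℝ} (c : ℝ) (hf : ∀ n i, IsTest (f n i))
    (cf : CurlCauchy f) : CurlCauchy (c • f) := by
  have h0 := ENNReal.Tendsto.const_mul (a := ‖c‖ₑ) cf (Or.inr enorm_ne_top)
  rw [mul_zero] at h0
  refine h0.congr fun p => ?_
  have hf' : ∀ i, IsTest ((f p.1 - f p.2) i) := fun i => (hf _ i).sub (hf _ i)
  have e : (c • f) p.1 - (c • f) p.2 = c • (f p.1 - f p.2) := by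
    simp only [Pi.smul_apply, smul_sub]
  simp only [e, curlNorm, curl_smul c hf', eLpNorm_const_smul]

theorem TendstoBL.add {f g : ℕ → Fin 3 → E3 → ℝ} {U V : BLdot3} (hf : ∀ n i, IsTest (f n i))
    (hg : ∀ n i, IsTest (g n i)) (tf : TendstoBL f U) (tg : TendstoBL g V) :
    TendstoBL (f + g) (U + V) := by
  obtain ⟨v, D, hv, h⟩ := tf
  obtain ⟨w, D', hw, h'⟩ := tg
  refine ⟨v + w, D + D', hv.add hw, fun i j => ⟨(h i j).1.add (h' i j).1,
    (h i j).2.1.add (h' i j).2.1, ?_⟩⟩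
  have h0 := (h i j).2.2.add (h' i j).2.2
  rw [add_zero] at h0
  refine tendsto_of_tendsto_of_tendsto_of_le_of_le tendsto_const_nhds h0 (fun _ => bot_le) ?_
  intro n
  have e : pd j ((f + g) n i) - (D + D') i j = (pd j (f n i) - D i j) + (pd j (g n i) - D' i j) := by
    simp only [Pi.add_apply, pd_add (hf n i) (hg n i)]; abel
  simp only [e]
  exact eLpNorm_add_le
    (((hf n i).pd j).1.continuous.aestronglyMeasurable.sub (h i j).1.aestronglyMeasurable)
    (((hg n i).pd j).1.continuous.aestronglyMeasurable.sub (h' i j).1.aestronglyMeasurable)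
    (by norm_num)

theorem TendstoBL.smul {f : ℕ → Fin 3 → E3 → ℝ} {U : BLdot3} (c : ℝ)
    (hf : ∀ n i, IsTest (f n i)) (tf : TendstoBL f U) : TendstoBL (c • f) (c • U) := by
  obtain ⟨v, D, hv, h⟩ := tf
  refine ⟨c • v, c • D, hv.smul c, fun i j => ⟨(h i j).1.const_smul c, (h i j).2.1.smul c, ?_⟩⟩
  have h0 := ENNReal.Tendsto.const_mul (a := ‖c‖ₑ) (h i j).2.2 (Or.inr enorm_ne_top)
  rw [mul_zero] at h0
  refine h0.congr fun n => ?_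
  have e : pd j ((c • f) n i) - (c • D) i j = c • (pd j (f n i) - D i j) := by
    simp only [Pi.smul_apply, pd_smul c (hf n i), smul_sub]
  simp only [e, eLpNorm_const_smul]

/-- The space `BLC(ℝ³)` modulo constants: the completion of the divergence free test fields
with respect to `|·|_{H(ℝ³,curl)}`, realized inside `BL(ℝ³)³` modulo constants. Its elements are
the limits of sequences of divergence free test fields that are Cauchy for
`|·|_{H(ℝ³,curl)}`; for such fields this norm equals the norm `‖∇ψ‖_{L₂}` in which the limit
is taken. -/
noncomputable def BLC : Submodule ℝ BLdot3 where
  carrier := {U | ∃ ψ : ℕ → Fin 3 → E3 → ℝ, (∀ n, IsSolenoidalTest (ψ n)) ∧ CurlCauchy ψ ∧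
    TendstoBL ψ U}
  zero_mem' := by
    refine ⟨0, fun n => IsSolenoidalTest.zero, ?_, 0, 0, Represents.zero, fun i j =>
      ⟨MemLp.zero, HasWeakDeriv.zero j, ?_⟩⟩
    · have e : curl 0 = 0 := by
        funext x; ext k; fin_cases k <;> simp [curl, pd]
      simp [CurlCauchy, curlNorm, e]
    · have e : pd j 0 = 0 := by
        funext x; simp [pd]
      simp [e]
  add_mem' := by
    rintro U V ⟨f, hf, cf, tf⟩ ⟨g, hg, cg, tg⟩
    exact ⟨f + g, fun n => (hf n).add (hg n),
      cf.add (fun n => (hf n).1) (fun n => (hg n).1) cg,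
      tf.add (fun n => (hf n).1) (fun n => (hg n).1) tg⟩
  smul_mem' := by
    rintro c U ⟨f, hf, cf, tf⟩
    exact ⟨c • f, fun n => (hf n).smul c, cf.smul c (fun n => (hf n).1),
      tf.smul c (fun n => (hf n).1)⟩

end BeppoLevi

/-!
The direct sum is the orthogonal decomposition of the gradient of a field in `L₂(ℝ³)^{3×3}`.

For existence, `∇u` is projected onto the closure of the Hessians of test functions, and the
remainder onto the closure of the gradients of solenoidal test fields
(`exists_hessian_decomposition`, `exists_solenoidal_decomposition`). Elements of the closures are
again Hessians and gradients: the Gagliardo-Nirenberg-Sobolev inequality `‖f‖₆ ≤ C‖∇f‖₂` makes test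
functions with convergent gradients converge in `L₆` (`exists_limit_of_tendsto_pd`), and a Poincaré
inequality for the weight `(1 + |x|)⁻¹⁰` does the same, up to constants, for test functions whose
gradients converge in `L₆` (`exists_poincare_const`, `exists_limit_of_tendsto_hessian`). The final
remainder `r` has curl-free rows. Orthogonality to Hessians makes its trace harmonic, orthogonality
to gradients of solenoidal fields makes its antisymmetric part harmonic, and a symmetric trace-free
field with curl-free rows is itself harmonic (`RowCurlFree.trace_eq_zero`,
`RowCurlFree.symm_of_orthogonal`, `RowCurlFree.eq_zero_of_symm_of_trace`). Each time Liouville's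
theorem in `L₂`, `ae_zero_of_integral_mul_lap_eq_zero`, shows that the function vanishes; it follows
from Caccioppoli's identity applied to mollifications. So `r = 0`.

The sum is direct (`disjoint_gradBL2_BLC`) because `∫ ∇ψ : D = ∫ ∇ψ : Dᵀ = 0` when `D` is a Hessian
with square integrable entries and `ψ` a solenoidal test field.

The same projection shows that a function in `BL²`, whose first derivatives are not presupposed,
has them: once the projection of its Hessian is removed, the remaining Hessian vanishes, and the
function is affine (`exists_hasWeakDeriv_of_mem_BL2`).
-/

namespace BeppoLevi

/-! ### Test functions and weak derivatives -/

theorem pd_comm {ψ : E3 → ℝ} (h : ContDiff ℝ ∞ ψ) (i j : Fin 3) :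
    pd i (pd j ψ) = pd j (pd i ψ) := by
  funext x
  have hd : DifferentiableAt ℝ (fderiv ℝ ψ) x :=
    (h.fderiv_right (m := ∞) (by simp)).differentiable (by simp) x
  have key : ∀ a b : Fin 3, pd a (pd b ψ) x
      = fderiv ℝ (fderiv ℝ ψ) x (EuclideanSpace.single a 1) (EuclideanSpace.single b 1) := by
    intro a b
    have : pd b ψ = fun y => fderiv ℝ ψ y (EuclideanSpace.single b 1) := rfl
    rw [pd, this, fderiv_clm_apply hd (differentiableAt_const _)]
    simp
  rw [key, key]
  have hs : IsSymmSndFDerivAt ℝ ψ x := h.contDiffAt.isSymmSndFDerivAt (by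
    simpa using (WithTop.coe_le_coe.2 (le_top : (2 : ℕ∞) ≤ ⊤) :
      ((2 : ℕ∞) : ℕ∞ω) ≤ ((⊤ : ℕ∞) : ℕ∞ω)))
  exact hs _ _

theorem IsTest.sum {ι : Type*} (s : Finset ι) {f : ι → E3 → ℝ} (hf : ∀ k, IsTest (f k)) :
    IsTest (∑ k ∈ s, f k) := by
  classical
  induction s using Finset.induction_on with
  | empty => simpa using IsTest.zero
  | insert a s ha ih => rw [Finset.sum_insert ha]; exact (hf a).add ih

theorem pd_zero (i : Fin 3) : pd i 0 = 0 := by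
  funext x; simp [pd]

theorem pd_sum {ι : Type*} (s : Finset ι) {f : ι → E3 → ℝ} (hf : ∀ k, IsTest (f k)) (i : Fin 3) :
    pd i (∑ k ∈ s, f k) = ∑ k ∈ s, pd i (f k) := by
  classical
  induction s using Finset.induction_on with
  | empty => simp [pd_zero]
  | insert a s ha ih =>
    rw [Finset.sum_insert ha, Finset.sum_insert ha, pd_add (hf a) (IsTest.sum s hf), ih]

theorem pd_sub {f g : E3 → ℝ} (hf : IsTest f) (hg : IsTest g) (i : Fin 3) :
    pd i (f - g) = pd i f - pd i g := by
  have h := pd_add hf (hg.smul (-1)) i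
  rw [pd_smul (-1) hg] at h
  simpa [sub_eq_add_neg] using h

/-- The Laplacian `∑ₖ ∂ₖ∂ₖψ`. -/
noncomputable def lap (ψ : E3 → ℝ) : E3 → ℝ := ∑ k, pd k (pd k ψ)

theorem IsTest.lap {ψ : E3 → ℝ} (h : IsTest ψ) : IsTest (lap ψ) :=
  IsTest.sum _ fun k => (h.pd k).pd k

theorem IsTest.integrable {ψ : E3 → ℝ} (h : IsTest ψ) : Integrable ψ :=
  h.1.continuous.integrable_of_hasCompactSupport h.2

theorem IsTest.memLp {ψ : E3 → ℝ} (h : IsTest ψ) (p : ℝ≥0∞) : MemLp ψ p volume :=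
  h.1.continuous.memLp_of_hasCompactSupport h.2

theorem IsTest.mul {f g : E3 → ℝ} (hf : IsTest f) (hg : ContDiff ℝ ∞ g) :
    IsTest (fun x => f x * g x) :=
  ⟨hf.1.mul hg, hf.2.mul_right⟩

/-- Integration by parts against a test function. -/
theorem integral_mul_pd {f ψ : E3 → ℝ} (hf : ContDiff ℝ ∞ f) (hψ : IsTest ψ) (i : Fin 3) :
    ∫ x, f x * pd i ψ x = -∫ x, pd i f x * ψ x := by
  have hc : Continuous (pd i f) :=
    ((hf.fderiv_right (m := ∞) (by simp)).clm_apply contDiff_const).continuous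
  refine integral_mul_fderiv_eq_neg_fderiv_mul_of_integrable
    (integrable_mul_test hc.locallyIntegrable hψ)
    (integrable_mul_test hf.continuous.locallyIntegrable (hψ.pd i))
    (integrable_mul_test hf.continuous.locallyIntegrable hψ)
    (fun x _ => hf.differentiable (by simp) x) (fun x _ => hψ.1.differentiable (by simp) x)

theorem hasWeakDeriv_of_isTest {f : E3 → ℝ} (hf : IsTest f) (i : Fin 3) :
    HasWeakDeriv i f (pd i f) :=
  ⟨hf.1.continuous.locallyIntegrable, (hf.pd i).1.continuous.locallyIntegrable,
    fun _ hψ => integral_mul_pd hf.1 hψ i⟩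

theorem HasWeakDeriv.sub {i : Fin 3} {f g f' g' : E3 → ℝ} (h : HasWeakDeriv i f g)
    (h' : HasWeakDeriv i f' g') : HasWeakDeriv i (f - f') (g - g') := by
  simpa [sub_eq_add_neg] using h.add (h'.smul (-1))

theorem HasWeakDeriv2.sub {i j : Fin 3} {f g f' g' : E3 → ℝ} (h : HasWeakDeriv2 i j f g)
    (h' : HasWeakDeriv2 i j f' g') : HasWeakDeriv2 i j (f - f') (g - g') := by
  simpa [sub_eq_add_neg] using h.add (h'.smul (-1))

theorem ae_eq_of_integral_mul_test {f g : E3 → ℝ} (hf : LocallyIntegrable f)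
    (hg : LocallyIntegrable g)
    (h : ∀ ψ, IsTest ψ → ∫ x, f x * ψ x = ∫ x, g x * ψ x) : f =ᵐ[volume] g := by
  refine ae_eq_of_integral_contDiff_smul_eq hf hg fun ψ h1 h2 => ?_
  simpa [mul_comm] using h ψ ⟨h1, h2⟩

theorem HasWeakDeriv.ae_unique {i : Fin 3} {f g g' : E3 → ℝ} (h : HasWeakDeriv i f g)
    (h' : HasWeakDeriv i f g') : g =ᵐ[volume] g' := by
  refine ae_eq_of_integral_mul_test h.2.1 h'.2.1 fun ψ hψ => ?_
  have h1 := h.2.2 ψ hψ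
  have h2 := h'.2.2 ψ hψ
  linarith

theorem HasWeakDeriv.congr {i : Fin 3} {f g f' g' : E3 → ℝ} (h : HasWeakDeriv i f g)
    (hf : f =ᵐ[volume] f') (hg : g =ᵐ[volume] g') : HasWeakDeriv i f' g' := by
  refine ⟨h.1.congr hf, h.2.1.congr hg, fun ψ hψ => ?_⟩
  have e1 : ∫ x, f' x * pd i ψ x = ∫ x, f x * pd i ψ x :=
    integral_congr_ae (by filter_upwards [hf] with x hx; rw [hx])
  have e2 : ∫ x, g' x * ψ x = ∫ x, g x * ψ x :=
    integral_congr_ae (by filter_upwards [hg] with x hx; rw [hx])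
  rw [e1, e2, h.2.2 ψ hψ]

theorem HasWeakDeriv2.of_hasWeakDeriv {i j : Fin 3} {f g k : E3 → ℝ} (h : HasWeakDeriv i f g)
    (h' : HasWeakDeriv j g k) : HasWeakDeriv2 i j f k := by
  refine ⟨h.1, h'.2.1, fun ψ hψ => ?_⟩
  rw [h.2.2 _ (hψ.pd j), h'.2.2 _ hψ, neg_neg]

theorem MemL2loc.locallyIntegrable {f : E3 → ℝ} (h : MemL2loc f) : LocallyIntegrable f := by
  rw [locallyIntegrable_iff]
  intro K hK
  have : IsFiniteMeasure (volume.restrict K) := ⟨by simpa using hK.measure_lt_top⟩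
  exact (h K hK).integrable (by norm_num)

theorem MemL2loc.of_memLp {f : E3 → ℝ} {p : ℝ≥0∞} (hp : 2 ≤ p) (h : MemLp f p volume) :
    MemL2loc f := fun K hK => by
  have : IsFiniteMeasure (volume.restrict K) := ⟨by simpa using hK.measure_lt_top⟩
  exact (h.restrict K).mono_exponent hp

theorem locallyIntegrable_of_memLp_two {f : E3 → ℝ} (h : MemLp f 2 volume) : LocallyIntegrable f :=
  (MemL2loc.of_memLp le_rfl h).locallyIntegrable

/-! ### Limits of weak derivatives -/

/-- Convergence in `L_{1,loc}(ℝ³)`. -/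
def TendstoL1loc (f : ℕ → E3 → ℝ) (g : E3 → ℝ) : Prop :=
  ∀ K : Set E3, IsCompact K →
    Tendsto (fun n => eLpNorm (f n - g) 1 (volume.restrict K)) atTop (𝓝 0)

theorem TendstoL1loc.of_tendsto_eLpNorm {f : ℕ → E3 → ℝ} {g : E3 → ℝ} {p : ℝ≥0∞} (hp : 1 ≤ p)
    (hf : ∀ n, AEStronglyMeasurable (f n) volume) (hg : AEStronglyMeasurable g volume)
    (h : Tendsto (fun n => eLpNorm (f n - g) p volume) atTop (𝓝 0)) : TendstoL1loc f g := by
  intro K hK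
  have hfin : volume K ≠ ⊤ := hK.measure_lt_top.ne
  have hc : (volume K) ^ (1 / (1 : ℝ≥0∞).toReal - 1 / p.toReal) ≠ ⊤ := by
    refine ENNReal.rpow_ne_top_of_nonneg ?_ hfin
    rcases eq_or_ne p ⊤ with rfl | hp'
    · simp
    · have : 1 ≤ p.toReal := by
        simpa using (ENNReal.toReal_le_toReal ENNReal.one_ne_top hp').2 hp
      simp only [ENNReal.toReal_one, div_one, one_div, sub_nonneg]
      exact inv_le_one_of_one_le₀ this
  have h0 := ENNReal.Tendsto.mul_const h (Or.inr hc)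
  rw [zero_mul] at h0
  refine tendsto_of_tendsto_of_tendsto_of_le_of_le tendsto_const_nhds h0 (fun _ => bot_le) ?_
  intro n
  have h1 := eLpNorm_le_eLpNorm_mul_rpow_measure_univ (μ := volume.restrict K) hp
    (((hf n).sub hg).restrict)
  rw [Measure.restrict_apply_univ] at h1
  exact h1.trans (mul_le_mul_left (eLpNorm_mono_measure _ Measure.restrict_le_self) _)

theorem TendstoL1loc.tendsto_integral {f : ℕ → E3 → ℝ} {g : E3 → ℝ}
    (hf : ∀ n, LocallyIntegrable (f n)) (hg : LocallyIntegrable g) (h : TendstoL1loc f g)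
    {ψ : E3 → ℝ} (hψ : IsTest ψ) :
    Tendsto (fun n => ∫ x, f n x * ψ x) atTop (𝓝 (∫ x, g x * ψ x)) := by
  obtain ⟨C, hC⟩ := hψ.2.exists_bound_of_continuous hψ.1.continuous
  have hK : IsCompact (tsupport ψ) := hψ.2
  have h0 := ENNReal.Tendsto.const_mul (a := ENNReal.ofReal C) (h _ hK)
    (Or.inr ENNReal.ofReal_ne_top)
  rw [mul_zero] at h0
  refine tendsto_integral_of_L1 _ (integrable_mul_test hg hψ).aestronglyMeasurable
    (Eventually.of_forall fun n => integrable_mul_test (hf n) hψ) ?_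
  refine tendsto_of_tendsto_of_tendsto_of_le_of_le tendsto_const_nhds h0 (fun _ => bot_le) ?_
  intro n
  beta_reduce
  rw [eLpNorm_one_eq_lintegral_enorm, ← lintegral_const_mul' _ _ ENNReal.ofReal_ne_top,
    ← lintegral_indicator hK.measurableSet]
  refine lintegral_mono fun x => ?_
  by_cases hx : x ∈ tsupport ψ
  · rw [Set.indicator_of_mem hx, ← sub_mul, enorm_mul, mul_comm]
    gcongr
    · rw [← ofReal_norm]
      exact ENNReal.ofReal_le_ofReal (hC x)
    · exact le_rfl
  · simp [image_eq_zero_of_notMem_tsupport hx]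

theorem HasWeakDeriv.of_tendsto {i : Fin 3} {f g : ℕ → E3 → ℝ} {F G : E3 → ℝ}
    (h : ∀ n, HasWeakDeriv i (f n) (g n)) (hF : LocallyIntegrable F) (hG : LocallyIntegrable G)
    (hf : TendstoL1loc f F) (hg : TendstoL1loc g G) : HasWeakDeriv i F G := by
  refine ⟨hF, hG, fun ψ hψ => ?_⟩
  have h1 := hf.tendsto_integral (fun n => (h n).1) hF (hψ.pd i)
  have h2 := (hg.tendsto_integral (fun n => (h n).2.1) hG hψ).neg
  refine tendsto_nhds_unique h1 (h2.congr fun n => ?_)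
  rw [(h n).2.2 ψ hψ]

/-! ### Mollification -/

/-- The convolution `f * ρ`, meant for locally integrable `f` and a test function `ρ`. -/
noncomputable def mollify (ρ f : E3 → ℝ) : E3 → ℝ :=
  convolution f ρ (ContinuousLinearMap.lsmul ℝ ℝ) volume

theorem mollify_apply (ρ f : E3 → ℝ) (x : E3) : mollify ρ f x = ∫ y, f y * ρ (x - y) := rfl

theorem contDiff_mollify {ρ f : E3 → ℝ} (hρ : IsTest ρ) (hf : LocallyIntegrable f) :
    ContDiff ℝ ∞ (mollify ρ f) :=
  hρ.2.contDiff_convolution_right _ hf hρ.1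

theorem pd_mollify {ρ f : E3 → ℝ} (hρ : IsTest ρ) (hf : LocallyIntegrable f) (i : Fin 3) :
    pd i (mollify ρ f) = mollify (pd i ρ) f := by
  funext x
  have h1 : ContDiff ℝ 1 ρ := hρ.1.of_le (by simp)
  rw [pd, mollify, (hρ.2.hasFDerivAt_convolution_right _ hf h1 x).fderiv,
    convolution_precompR_apply _ hf (hρ.2.fderiv ℝ) (h1.continuous_fderiv one_ne_zero)]
  rfl

theorem IsTest.comp_sub_left {ρ : E3 → ℝ} (hρ : IsTest ρ) (x : E3) :
    IsTest (fun y => ρ (x - y)) :=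
  ⟨hρ.1.comp (contDiff_const.sub contDiff_id),
    hρ.2.comp_homeomorph (Homeomorph.subLeft x)⟩

theorem pd_comp_sub_left {ρ : E3 → ℝ} (hρ : IsTest ρ) (x : E3) (i : Fin 3) :
    pd i (fun y => ρ (x - y)) = (-1 : ℝ) • fun y => pd i ρ (x - y) := by
  funext y
  have h1 : HasFDerivAt ρ (fderiv ℝ ρ (x - y)) (x - y) :=
    (hρ.1.differentiable (by simp) _).hasFDerivAt
  have h2 : HasFDerivAt (fun y : E3 => x - y) (-ContinuousLinearMap.id ℝ E3) y := by
    simpa using (hasFDerivAt_id y).const_sub x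
  have h3 : HasFDerivAt (fun y => ρ (x - y))
      ((fderiv ℝ ρ (x - y)).comp (-ContinuousLinearMap.id ℝ E3)) y := h1.comp y h2
  rw [pd, h3.fderiv]
  simp [pd]

theorem pd_pd_comp_sub_left {ρ : E3 → ℝ} (hρ : IsTest ρ) (x : E3) (i j : Fin 3) :
    pd i (pd j (fun y => ρ (x - y))) = fun y => pd i (pd j ρ) (x - y) := by
  rw [pd_comp_sub_left hρ, pd_smul _ ((hρ.pd j).comp_sub_left x),
    pd_comp_sub_left (hρ.pd j), smul_smul]
  simp

theorem lap_comp_sub_left {ρ : E3 → ℝ} (hρ : IsTest ρ) (x : E3) :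
    lap (fun y => ρ (x - y)) = fun y => lap ρ (x - y) := by
  funext y
  simp only [lap, pd_pd_comp_sub_left hρ, Finset.sum_apply]

theorem exists_mollifiers : ∃ ρ : ℕ → E3 → ℝ, (∀ n, IsTest (ρ n)) ∧ (∀ n x, 0 ≤ ρ n x) ∧
    (∀ n, ∫ x, ρ n x = 1) ∧ ∀ f : E3 → ℝ, LocallyIntegrable f →
      ∀ᵐ x, Tendsto (fun n => mollify (ρ n) f x) atTop (𝓝 (f x)) := by
  let φ : ℕ → ContDiffBump (0 : E3) := fun n =>
    ⟨1 / ((n : ℝ) + 1), 2 * (1 / ((n : ℝ) + 1)), by positivity, by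
      have : (0 : ℝ) < 1 / ((n : ℝ) + 1) := by positivity
      linarith⟩
  refine ⟨fun n => (φ n).normed volume,
    fun n => ⟨(φ n).contDiff_normed, (φ n).hasCompactSupport_normed⟩,
    fun n x => (φ n).nonneg_normed x, fun n => (φ n).integral_normed, fun f hf => ?_⟩
  have h0 : Tendsto (fun n => (φ n).rOut) atTop (𝓝 0) := by
    have h1 := (tendsto_one_div_add_atTop_nhds_zero_nat (𝕜 := ℝ)).const_mul 2
    rwa [mul_zero] at h1
  filter_upwards [ContDiffBump.ae_convolution_tendsto_right_of_locallyIntegrable (μ := volume)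
    (φ := φ) (K := 2) h0 (Eventually.of_forall fun n => le_rfl) hf] with x hx
  refine hx.congr fun n => ?_
  rw [convolution_lsmul_swap, mollify_apply]
  simp only [smul_eq_mul, mul_comm]

theorem fderiv_eq_zero_of_pd {g : E3 → ℝ} {x : E3} (h : ∀ i, pd i g x = 0) :
    fderiv ℝ g x = 0 := by
  ext v
  have hv : v = ∑ i, v i • EuclideanSpace.single i (1 : ℝ) := by
    ext k
    fin_cases k <;> simp [Fin.sum_univ_three]
  rw [hv, map_sum]
  refine Finset.sum_eq_zero fun i _ => ?_
  rw [map_smul]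
  have := h i
  rw [pd] at this
  rw [this, smul_zero]

theorem eq_const_of_pd_eq_zero {g : E3 → ℝ} (hg : ContDiff ℝ ∞ g) (h : ∀ i x, pd i g x = 0)
    (x y : E3) : g x = g y :=
  is_const_of_fderiv_eq_zero (hg.differentiable (by simp))
    (fun x => fderiv_eq_zero_of_pd fun i => h i x) x y

/-- A function with vanishing weak gradient is a.e. constant, being the a.e. limit of its
mollifications, which are constant. -/
theorem ae_const_of_hasWeakDeriv_zero {f : E3 → ℝ} (h : ∀ i, HasWeakDeriv i f 0) :
    ∃ c : ℝ, ∀ᵐ x, f x = c := by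
  obtain ⟨ρ, hρ, -, -, hlim⟩ := exists_mollifiers
  have hf : LocallyIntegrable f := (h 0).1
  have hc : ∀ n x, mollify (ρ n) f x = mollify (ρ n) f 0 := by
    refine fun n x => eq_const_of_pd_eq_zero (contDiff_mollify (hρ n) hf) (fun i y => ?_) x 0
    rw [pd_mollify (hρ n) hf, mollify_apply]
    have h1 := (h i).2.2 _ ((hρ n).comp_sub_left y)
    rw [pd_comp_sub_left (hρ n)] at h1
    simpa [integral_neg] using h1
  have hl := hlim f hf
  obtain ⟨x₀, hx₀⟩ := hl.exists
  refine ⟨f x₀, ?_⟩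
  filter_upwards [hl] with x hx
  refine tendsto_nhds_unique hx (hx₀.congr fun n => ?_)
  rw [hc n x, hc n x₀]

theorem pd_const_add_inner (b : ℝ) (a x : E3) (i : Fin 3) :
    pd i (fun y => b + inner ℝ a y) x = a i := by
  have h : HasFDerivAt (fun y : E3 => b + inner ℝ a y) (innerSL ℝ a) x := by
    simpa using ((innerSL ℝ a).hasFDerivAt (x := x)).const_add b
  rw [pd, h.fderiv]
  simp [EuclideanSpace.inner_single_right]

theorem contDiff_const_add_inner (b : ℝ) (a : E3) :
    ContDiff ℝ ∞ (fun y : E3 => b + inner ℝ a y) :=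
  contDiff_const.add (contDiff_const.inner ℝ contDiff_id)

theorem hasWeakDeriv_affine (b : ℝ) (a : E3) (i : Fin 3) :
    HasWeakDeriv i (fun y : E3 => b + inner ℝ a y) (fun _ => a i) := by
  have hc := contDiff_const_add_inner b a
  refine ⟨hc.continuous.locallyIntegrable, continuous_const.locallyIntegrable, fun ψ hψ => ?_⟩
  rw [integral_mul_pd hc hψ]
  simp only [pd_const_add_inner]

theorem hasWeakDeriv_const (c : ℝ) (i : Fin 3) : HasWeakDeriv i (fun _ => c) 0 := by
  have := hasWeakDeriv_affine c 0 i
  simp only [inner_zero_left, add_zero, PiLp.zero_apply] at this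
  exact this

/-- If `⟪aₙ, x - x₀⟫` converges for almost every `x`, then `⟪aₙ, v⟫` converges for every `v`: the
directions of convergence form a subspace, and proper subspaces are null sets. -/
theorem exists_tendsto_inner_of_ae {a : ℕ → E3} {x₀ : E3}
    (h : ∀ᵐ x : E3, ∃ l : ℝ, Tendsto (fun n => inner ℝ (a n) (x - x₀)) atTop (𝓝 l)) (v : E3) :
    ∃ l : ℝ, Tendsto (fun n => inner ℝ (a n) v) atTop (𝓝 l) := by
  let V : Submodule ℝ E3 :=
    { carrier := {v | ∃ l : ℝ, Tendsto (fun n => inner ℝ (a n) v) atTop (𝓝 l)}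
      zero_mem' := ⟨0, by simp⟩
      add_mem' := by
        rintro v w ⟨l, hl⟩ ⟨m, hm⟩
        exact ⟨l + m, by simpa only [inner_add_right] using hl.add hm⟩
      smul_mem' := by
        rintro c v ⟨l, hl⟩
        exact ⟨c * l, by simpa only [real_inner_smul_right] using hl.const_mul c⟩ }
  have hV : V = ⊤ := by
    by_contra hne
    have h0 : volume (V : Set E3) = 0 := Measure.addHaar_submodule volume V hne
    have h1 : volume ((fun x => x - x₀) ⁻¹' (V : Set E3)) = 0 := by
      simpa only [sub_eq_add_neg, measure_preimage_add_right] using h0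
    have h2 : ∀ᵐ x : E3, False := by
      filter_upwards [h, measure_eq_zero_iff_ae_notMem.1 h1] with x hx hx'
      exact hx' hx
    exact h2.exists.choose_spec
  have : v ∈ V := hV ▸ Submodule.mem_top
  exact this

/-- A function whose weak second derivatives all vanish is a.e. affine: its mollifications are
affine, and they converge almost everywhere. -/
theorem ae_affine_of_hasWeakDeriv2_zero {f : E3 → ℝ} (h : ∀ i j, HasWeakDeriv2 i j f 0) :
    ∃ (b : ℝ) (a : E3), ∀ᵐ x, f x = b + inner ℝ a x := by
  obtain ⟨ρ, hρ, -, -, hlim⟩ := exists_mollifiers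
  have hf : LocallyIntegrable f := (h 0 0).1
  set g : ℕ → E3 → ℝ := fun n => mollify (ρ n) f with hg
  have hgs : ∀ n, ContDiff ℝ ∞ (g n) := fun n => contDiff_mollify (hρ n) hf
  have hpp : ∀ n i j x, pd i (pd j (g n)) x = 0 := by
    intro n i j x
    rw [hg]
    simp only
    rw [pd_mollify (hρ n) hf, pd_mollify ((hρ n).pd j) hf, mollify_apply]
    have h1 := (h i j).2.2 _ ((hρ n).comp_sub_left x)
    rw [pd_pd_comp_sub_left (hρ n)] at h1
    simpa using h1
  set a : ℕ → E3 := fun n => WithLp.toLp 2 fun i => pd i (g n) 0 with ha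
  have hgrad : ∀ n i x, pd i (g n) x = a n i := fun n i x =>
    eq_const_of_pd_eq_zero
      (((hgs n).fderiv_right (m := ∞) (by simp)).clm_apply contDiff_const)
      (fun j y => hpp n j i y) x 0
  have haff : ∀ n x, g n x = g n 0 + inner ℝ (a n) x := by
    intro n x
    have hd : ContDiff ℝ ∞ (fun y => g n y - (0 + inner ℝ (a n) y)) :=
      (hgs n).sub (contDiff_const_add_inner 0 (a n))
    have h2 := eq_const_of_pd_eq_zero hd (fun i y => ?_) x 0
    · simp only [zero_add, inner_zero_right, sub_zero] at h2
      linarith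
    · have e1 : DifferentiableAt ℝ (g n) y := (hgs n).differentiable (by simp) y
      have e2 : DifferentiableAt ℝ (fun y => 0 + inner ℝ (a n) y) y :=
        (contDiff_const_add_inner 0 (a n)).differentiable (by simp) y
      have e3 := pd_const_add_inner 0 (a n) y i
      rw [pd] at e3
      rw [pd, fderiv_fun_sub e1 e2, sub_apply, e3, ← hgrad n i y, pd, sub_self]
  have hl := hlim f hf
  obtain ⟨x₀, hx₀⟩ := hl.exists
  -- the slopes `aₙ` converge, because `⟪aₙ, x - x₀⟫ = gₙ x - gₙ x₀` converges for a.e. `x`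
  have hv := exists_tendsto_inner_of_ae (a := a) (x₀ := x₀) (by
    filter_upwards [hl] with x hx
    refine ⟨f x - f x₀, (hx.sub hx₀).congr fun n => ?_⟩
    have e1 := haff n x
    have e2 := haff n x₀
    simp only [hg] at e1 e2
    rw [e1, e2, inner_sub_right]
    ring)
  choose l hl' using fun i : Fin 3 => hv (EuclideanSpace.single i 1)
  have hα : ∀ x : E3, Tendsto (fun n => inner ℝ (a n) x) atTop
      (𝓝 (inner ℝ (WithLp.toLp 2 l : E3) x)) := by
    intro x
    have h3 : ∀ u : E3, inner ℝ u x = ∑ i, inner ℝ u (EuclideanSpace.single i 1) * x i := by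
      intro u
      simp [PiLp.inner_apply, Fin.sum_univ_three, mul_comm]
    rw [h3]
    simp only [h3 (a _)]
    refine tendsto_finsetSum _ fun i _ => ?_
    have := (hl' i).mul_const (x i)
    simpa [EuclideanSpace.inner_single_right] using this
  refine ⟨f x₀ - inner ℝ (WithLp.toLp 2 l : E3) x₀, WithLp.toLp 2 l, ?_⟩
  filter_upwards [hl] with x hx
  refine tendsto_nhds_unique hx (((hx₀.sub (hα x₀)).add (hα x)).congr fun n => ?_)
  have e1 := haff n x
  have e2 := haff n x₀
  simp only [hg] at e1 e2
  rw [e1, e2]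
  ring

/-! ### Liouville's theorem for harmonic functions in `L₂` -/

theorem memLp_mollify {ρ f : E3 → ℝ} (hρ : IsTest ρ) (h0 : ∀ x, 0 ≤ ρ x) (h1 : ∫ x, ρ x = 1)
    (hf : MemLp f 2 volume) : MemLp (mollify ρ f) 2 volume := by
  have hfl := locallyIntegrable_of_memLp_two hf
  have hc := (contDiff_mollify hρ hfl).continuous
  have hint : Integrable (mollify ρ fun x => f x ^ 2) volume :=
    hf.integrable_sq.integrable_convolution _ hρ.integrable
  rw [memLp_two_iff_integrable_sq hc.aestronglyMeasurable]
  refine hint.mono' (hc.pow 2).aestronglyMeasurable (Eventually.of_forall fun x => ?_)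
  have hρx := hρ.comp_sub_left x
  set m := mollify ρ f x with hm
  have i1 : Integrable (fun y => f y ^ 2 * ρ (x - y)) :=
    integrable_mul_test hf.integrable_sq.locallyIntegrable hρx
  have i2 : Integrable (fun y => f y * ρ (x - y)) := integrable_mul_test hfl hρx
  have i3 : Integrable (fun y => ρ (x - y)) := hρx.integrable
  -- the variance of `f` under the probability density `ρ (x - ·)` is nonnegative
  have key : 0 ≤ ∫ y, (f y - m) ^ 2 * ρ (x - y) :=
    integral_nonneg fun y => mul_nonneg (sq_nonneg _) (h0 _)
  have e : ∀ y, (f y - m) ^ 2 * ρ (x - y)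
      = f y ^ 2 * ρ (x - y) - 2 * m * (f y * ρ (x - y)) + m ^ 2 * ρ (x - y) := fun y => by ring
  simp only [e] at key
  rw [integral_add (by exact i1.sub (i2.const_mul _)) (i3.const_mul _),
    integral_sub i1 (i2.const_mul _),
    integral_const_mul, integral_const_mul, ← mollify_apply ρ f x, ← hm,
    integral_sub_left_eq_self ρ volume x, h1] at key
  rw [Real.norm_of_nonneg (sq_nonneg _), mollify_apply]
  nlinarith

theorem pd_mul {f g : E3 → ℝ} (hf : ContDiff ℝ ∞ f) (hg : ContDiff ℝ ∞ g) (i : Fin 3) :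
    pd i (fun x => f x * g x) = fun x => pd i f x * g x + f x * pd i g x := by
  funext x
  have h1 : DifferentiableAt ℝ f x := hf.differentiable (by simp) x
  have h2 : DifferentiableAt ℝ g x := hg.differentiable (by simp) x
  rw [pd, fderiv_fun_mul h1 h2]
  simp [pd]
  ring

theorem contDiff_pd {f : E3 → ℝ} (hf : ContDiff ℝ ∞ f) (i : Fin 3) : ContDiff ℝ ∞ (pd i f) :=
  (hf.fderiv_right (m := ∞) (by simp)).clm_apply contDiff_const

/-- The Caccioppoli identity `∫ |∇(ηg)|² = ∫ g² |∇η|²` for harmonic `g`. -/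
theorem integral_sq_pd_cutoff_mul {g η : E3 → ℝ} (hg : ContDiff ℝ ∞ g) (hlap : ∀ x, lap g x = 0)
    (hη : IsTest η) :
    ∑ i, ∫ x, pd i (fun x => η x * g x) x ^ 2 = ∑ i, ∫ x, g x ^ 2 * pd i η x ^ 2 := by
  have hηη : IsTest (fun x => η x * (η x * g x)) := hη.mul (hη.mul hg).1
  have key : ∀ i, ∫ x, pd i (fun x => η x * g x) x ^ 2
      = (∫ x, g x ^ 2 * pd i η x ^ 2) - ∫ x, pd i (pd i g) x * (η x * (η x * g x)) := by
    intro i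
    have hgi := contDiff_pd hg i
    have h1 := integral_mul_pd hgi hηη i
    have i1 : Integrable (fun x => g x ^ 2 * pd i η x ^ 2) := by
      have := integrable_mul_test (hg.pow 2).continuous.locallyIntegrable
        ((hη.pd i).mul (hη.pd i).1)
      simpa only [← sq] using this
    have i2 : Integrable (fun x => pd i g x * pd i (fun x => η x * (η x * g x)) x) :=
      integrable_mul_test hgi.continuous.locallyIntegrable (hηη.pd i)
    rw [sub_eq_add_neg, ← h1, ← integral_add i1 i2]
    refine integral_congr_ae (Eventually.of_forall fun x => ?_)
    simp only [pd_mul hη.1 hg, pd_mul hη.1 (hη.mul hg).1]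
    ring
  simp only [key, Finset.sum_sub_distrib, sub_eq_self]
  rw [← integral_finsetSum _ fun i _ =>
    integrable_mul_test (contDiff_pd (contDiff_pd hg i) i).continuous.locallyIntegrable hηη]
  simp only [← Finset.sum_mul]
  have : ∀ x, ∑ i, pd i (pd i g) x = 0 := fun x => by simpa [lap] using hlap x
  simp [this]

theorem IsTest.comp_smul {η : E3 → ℝ} (hη : IsTest η) {c : ℝ} (hc : c ≠ 0) :
    IsTest (fun x => η (c • x)) :=
  ⟨hη.1.comp (contDiff_const_smul c), hη.2.comp_homeomorph (Homeomorph.smulOfNeZero c hc)⟩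

theorem pd_comp_smul {η : E3 → ℝ} (hη : IsTest η) (c : ℝ) (i : Fin 3) (x : E3) :
    pd i (fun x => η (c • x)) x = c * pd i η (c • x) := by
  have h1 : HasFDerivAt η (fderiv ℝ η (c • x)) (c • x) :=
    (hη.1.differentiable (by simp) _).hasFDerivAt
  have h2 : HasFDerivAt (fun y : E3 => c • y) (c • ContinuousLinearMap.id ℝ E3) x :=
    (hasFDerivAt_id x).const_smul c
  have h3 : HasFDerivAt (fun y => η (c • y))
      ((fderiv ℝ η (c • x)).comp (c • ContinuousLinearMap.id ℝ E3)) x := h1.comp x h2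
  rw [pd, h3.fderiv]
  simp [pd]

theorem exists_cutoff : ∃ η : E3 → ℝ, IsTest η ∧ ∀ x, ‖x‖ ≤ 1 → η x = 1 := by
  let φ : ContDiffBump (0 : E3) := ⟨1, 2, one_pos, one_lt_two⟩
  exact ⟨φ, ⟨φ.contDiff, φ.hasCompactSupport⟩, fun x hx =>
    φ.one_of_mem_closedBall (by simpa [φ] using hx)⟩

/-- A smooth harmonic function in `L₂` has vanishing gradient: apply Caccioppoli's identity to
cutoffs at scale `R → ∞`. -/
theorem hasWeakDeriv_zero_of_harmonic {g : E3 → ℝ} (hg : ContDiff ℝ ∞ g)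
    (hlap : ∀ x, lap g x = 0) (hL : MemLp g 2 volume) (i : Fin 3) : HasWeakDeriv i g 0 := by
  refine ⟨hg.continuous.locallyIntegrable, locallyIntegrable_zero, fun ψ hψ => ?_⟩
  obtain ⟨η, hη, hη1⟩ := exists_cutoff
  have hb : ∀ k, ∃ C, ∀ x, ‖pd k η x‖ ≤ C := fun k =>
    (hη.pd k).2.exists_bound_of_continuous (hη.pd k).1.continuous
  choose C hC using hb
  -- `A R⁻²` will bound `‖∇(η(·/R) g)‖²`
  set A : ℝ := ∑ k, C k ^ 2 * ∫ x, g x ^ 2 with hA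
  set B : ℝ := ∫ x, ψ x ^ 2 with hB
  obtain ⟨r, hr⟩ := hψ.2.isCompact.isBounded.subset_closedBall (0 : E3)
  -- `∫ g ∂ᵢψ = -∫ ∂ᵢ(η(·/R) g) ψ`, and the `L₂` norm of the first factor is `O(1/R)`
  have key : ∀ R : ℝ, 1 ≤ R → r ≤ R → |∫ x, g x * pd i ψ x| ≤ (A + B) * (1 / R) := by
    intro R hR1 hrR
    have hR : 0 < R := by linarith
    have hηR : IsTest (fun x => η (R⁻¹ • x)) := hη.comp_smul (inv_ne_zero hR.ne')
    set u : E3 → ℝ := fun x => η (R⁻¹ • x) * g x with hu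
    have hut : IsTest u := hηR.mul hg
    have e1 : ∫ x, g x * pd i ψ x = ∫ x, u x * pd i ψ x := by
      refine integral_congr_ae (Eventually.of_forall fun x => ?_)
      by_cases hx : x ∈ tsupport ψ
      · have hxr : ‖x‖ ≤ R := by simpa using (hr hx).trans hrR
        have : ‖R⁻¹ • x‖ ≤ 1 := by
          rw [norm_smul, norm_inv, Real.norm_of_nonneg hR.le, inv_mul_le_iff₀ hR]
          linarith
        simp only [hu, hη1 _ this, one_mul]
      · have : pd i ψ x = 0 := by
          have h2 : fderiv ℝ ψ x = 0 :=
            image_eq_zero_of_notMem_tsupport fun h => hx (tsupport_fderiv_subset ℝ h)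
          rw [pd, h2]; rfl
        simp only [this, mul_zero]
    have e2 : ∑ k, ∫ x, pd k u x ^ 2 ≤ A * (1 / R ^ 2) := by
      rw [integral_sq_pd_cutoff_mul hg hlap hηR, hA, Finset.sum_mul]
      refine Finset.sum_le_sum fun k _ => ?_
      rw [mul_right_comm, ← integral_const_mul]
      refine integral_mono_of_nonneg (Eventually.of_forall fun x => by positivity)
        (hL.integrable_sq.const_mul _) (Eventually.of_forall fun x => ?_)
      simp only [pd_comp_smul hη]
      have h3 : pd k η (R⁻¹ • x) ^ 2 ≤ C k ^ 2 := by
        rw [← sq_abs]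
        exact pow_le_pow_left₀ (abs_nonneg _) (hC k _) 2
      calc g x ^ 2 * (R⁻¹ * pd k η (R⁻¹ • x)) ^ 2
          = (1 / R ^ 2 * g x ^ 2) * pd k η (R⁻¹ • x) ^ 2 := by field_simp
        _ ≤ (1 / R ^ 2 * g x ^ 2) * C k ^ 2 := by gcongr
        _ = C k ^ 2 * (1 / R ^ 2) * g x ^ 2 := by ring
    have e3 : ∫ x, pd i u x ^ 2 ≤ A * (1 / R ^ 2) :=
      (Finset.single_le_sum (f := fun k => ∫ x, pd k u x ^ 2)
        (fun k _ => integral_nonneg fun x => sq_nonneg _) (Finset.mem_univ i)).trans e2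
    have i1 : Integrable (fun x => pd i u x ^ 2) := ((hut.pd i).memLp 2).integrable_sq
    have i2 : Integrable (fun x => ψ x ^ 2) := (hψ.memLp 2).integrable_sq
    rw [e1, integral_mul_pd hut.1 hψ, abs_neg]
    calc |∫ x, pd i u x * ψ x| ≤ ∫ x, |pd i u x * ψ x| := abs_integral_le_integral_abs
      _ ≤ ∫ x, (R * pd i u x ^ 2 + 1 / R * ψ x ^ 2) := by
          refine integral_mono_of_nonneg (Eventually.of_forall fun x => abs_nonneg _)
            ((i1.const_mul _).add (i2.const_mul _)) (Eventually.of_forall fun x => ?_)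
          have h4 : R * pd i u x ^ 2 + 1 / R * ψ x ^ 2
              = (1 / R) * ((R * |pd i u x| - |ψ x|) ^ 2) + 2 * |pd i u x * ψ x| := by
            rw [abs_mul, ← sq_abs (pd i u x), ← sq_abs (ψ x)]
            field_simp
            ring
          have h5 : 0 ≤ (1 / R) * ((R * |pd i u x| - |ψ x|) ^ 2) := by positivity
          have h6 := abs_nonneg (pd i u x * ψ x)
          simp only
          linarith
      _ = R * (∫ x, pd i u x ^ 2) + 1 / R * B := by
          rw [integral_add (i1.const_mul _) (i2.const_mul _), integral_const_mul,
            integral_const_mul]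
      _ ≤ R * (A * (1 / R ^ 2)) + 1 / R * B := by gcongr
      _ = (A + B) * (1 / R) := by field_simp
  have hlim : Tendsto (fun R : ℝ => (A + B) * (1 / R)) atTop (𝓝 0) := by
    simpa using tendsto_inv_atTop_zero.const_mul (A + B)
  have h0 : |∫ x, g x * pd i ψ x| ≤ 0 :=
    ge_of_tendsto hlim (by
      filter_upwards [eventually_ge_atTop 1, eventually_ge_atTop r] with R h1 h2 using key R h1 h2)
  simpa using abs_nonpos_iff.1 h0

/-- A distributionally harmonic function in `L₂(ℝ³)` vanishes. -/
theorem ae_zero_of_integral_mul_lap_eq_zero {f : E3 → ℝ} (hf : MemLp f 2 volume)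
    (h : ∀ χ, IsTest χ → ∫ x, f x * lap χ x = 0) : f =ᵐ[volume] 0 := by
  obtain ⟨ρ, hρ, hρ0, hρ1, hlim⟩ := exists_mollifiers
  have hfl := locallyIntegrable_of_memLp_two hf
  have hz : ∀ n, mollify (ρ n) f =ᵐ[volume] 0 := by
    intro n
    have hs := contDiff_mollify (hρ n) hfl
    have hm := memLp_mollify (hρ n) (hρ0 n) (hρ1 n) hf
    have hl : ∀ x, lap (mollify (ρ n) f) x = 0 := by
      intro x
      have h1 := h _ ((hρ n).comp_sub_left x)
      rw [lap_comp_sub_left (hρ n)] at h1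
      rw [← h1]
      simp only [lap, pd_mollify (hρ n) hfl, pd_mollify ((hρ n).pd _) hfl, Finset.sum_apply,
        mollify_apply, Finset.mul_sum]
      rw [integral_finsetSum _ fun k _ =>
        integrable_mul_test hfl ((((hρ n).pd k).pd k).comp_sub_left x)]
    obtain ⟨c, hc⟩ := ae_const_of_hasWeakDeriv_zero (hasWeakDeriv_zero_of_harmonic hs hl hm)
    have hc0 : MemLp (fun _ : E3 => c) 2 volume := hm.ae_eq hc
    rw [memLp_const_iff (by norm_num) (by norm_num)] at hc0
    have : c = 0 := by simpa using hc0
    filter_upwards [hc] with x hx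
    rw [hx, this]; rfl
  filter_upwards [hlim f hfl, ae_all_iff.2 hz] with x hx hx0
  refine tendsto_nhds_unique hx ?_
  simp [hx0]

/-! ### Completeness and the Sobolev inequality -/

theorem exists_tendsto_eLpNorm_of_cauchy {p : ℝ≥0∞} (hp : 1 ≤ p) {μ : Measure E3}
    {f : ℕ → E3 → ℝ} (hf : ∀ n, MemLp (f n) p μ)
    (hc : Tendsto (fun q : ℕ × ℕ => eLpNorm (f q.1 - f q.2) p μ) atTop (𝓝 0)) :
    ∃ F, MemLp F p μ ∧ Tendsto (fun n => eLpNorm (f n - F) p μ) atTop (𝓝 0) := by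
  have : Fact (1 ≤ p) := ⟨hp⟩
  have h : CauchySeq fun n => (hf n).toLp (f n) := by
    rw [Lp.cauchySeq_Lp_iff_cauchySeq_eLpNorm]
    refine hc.congr fun q => eLpNorm_congr_ae ?_
    exact ((hf q.1).coeFn_toLp.sub (hf q.2).coeFn_toLp).symm
  obtain ⟨F, hF⟩ := cauchySeq_tendsto_of_complete h
  refine ⟨F, Lp.memLp F, ?_⟩
  have hF' : Tendsto (fun n => (hf n).toLp (f n)) atTop (𝓝 ((Lp.memLp F).toLp F)) := by
    rwa [Lp.toLp_coeFn]
  exact (Lp.tendsto_Lp_iff_tendsto_eLpNorm'' f hf F (Lp.memLp F)).1 hF'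

theorem cauchy_of_tendsto_eLpNorm {p : ℝ≥0∞} (hp : 1 ≤ p) {μ : Measure E3} {f : ℕ → E3 → ℝ}
    {F : E3 → ℝ} (hf : ∀ n, AEStronglyMeasurable (f n) μ) (hF : AEStronglyMeasurable F μ)
    (h : Tendsto (fun n => eLpNorm (f n - F) p μ) atTop (𝓝 0)) :
    Tendsto (fun q : ℕ × ℕ => eLpNorm (f q.1 - f q.2) p μ) atTop (𝓝 0) := by
  rw [← prod_atTop_atTop_eq]
  have hl : Tendsto (fun q : ℕ × ℕ => eLpNorm (f q.1 - F) p μ) (atTop ×ˢ atTop) (𝓝 0) :=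
    h.comp tendsto_fst
  have hr : Tendsto (fun q : ℕ × ℕ => eLpNorm (f q.2 - F) p μ) (atTop ×ˢ atTop) (𝓝 0) :=
    h.comp tendsto_snd
  have h0 := hl.add hr
  rw [add_zero] at h0
  refine tendsto_of_tendsto_of_tendsto_of_le_of_le tendsto_const_nhds h0 (fun _ => bot_le) ?_
  rintro ⟨m, n⟩
  have e : f m - f n = (f m - F) - (f n - F) := by abel
  simp only [e]
  exact eLpNorm_sub_le ((hf m).sub hF) ((hf n).sub hF) hp

theorem norm_fderiv_le_sum_pd (f : E3 → ℝ) (x : E3) : ‖fderiv ℝ f x‖ ≤ ∑ i, ‖pd i f x‖ := by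
  refine ContinuousLinearMap.opNorm_le_bound _ (Finset.sum_nonneg fun i _ => norm_nonneg _)
    fun v => ?_
  have hv : v = ∑ i, v i • EuclideanSpace.single i (1 : ℝ) := by
    ext k
    fin_cases k <;> simp [Fin.sum_univ_three]
  calc ‖fderiv ℝ f x v‖ = ‖∑ i, v i * pd i f x‖ := by
        conv_lhs => rw [hv]
        simp [pd]
    _ ≤ ∑ i, ‖v i * pd i f x‖ := norm_sum_le _ _
    _ ≤ ∑ i, ‖pd i f x‖ * ‖v‖ := by
        refine Finset.sum_le_sum fun i _ => ?_
        rw [norm_mul, mul_comm]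
        exact mul_le_mul_of_nonneg_left (PiLp.norm_apply_le v i) (norm_nonneg _)
    _ = (∑ i, ‖pd i f x‖) * ‖v‖ := by rw [Finset.sum_mul]

theorem eLpNorm_fderiv_le_sum_pd {f : E3 → ℝ} (hf : IsTest f) {p : ℝ≥0∞} (hp : 1 ≤ p) :
    eLpNorm (fderiv ℝ f) p volume ≤ ∑ i, eLpNorm (pd i f) p volume := by
  have h1 : eLpNorm (fderiv ℝ f) p volume ≤ eLpNorm (∑ i, fun x => ‖pd i f x‖) p volume := by
    refine eLpNorm_mono fun x => ?_
    rw [Finset.sum_apply, Real.norm_of_nonneg (Finset.sum_nonneg fun i _ => norm_nonneg _)]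
    exact norm_fderiv_le_sum_pd f x
  refine h1.trans ((eLpNorm_sum_le
    (fun i _ => ((hf.pd i).1.continuous.norm).aestronglyMeasurable) hp).trans ?_)
  simp only [eLpNorm_norm, le_refl]

/-- The Gagliardo-Nirenberg-Sobolev inequality `‖f‖₆ ≤ C ‖∇f‖₂` in three dimensions. -/
theorem exists_sobolev_const : ∃ C : ℝ≥0∞, C ≠ ⊤ ∧ ∀ f : E3 → ℝ, IsTest f →
    eLpNorm f 6 volume ≤ C * ∑ i, eLpNorm (pd i f) 2 volume := by
  refine ⟨SNormLESNormFDerivOfEqConst ℝ (volume : Measure E3) ((2 : NNReal) : ℝ), by simp,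
    fun f hf => ?_⟩
  have h := eLpNorm_le_eLpNorm_fderiv_of_eq (F := ℝ) (μ := (volume : Measure E3)) (u := f)
    (p := 2) (p' := 6) (hf.1.of_le (by simp)) hf.2 (by norm_num) (by simp)
    (by simp; norm_num)
  refine h.trans ?_
  gcongr
  exact eLpNorm_fderiv_le_sum_pd hf (by norm_num)

/-- If the gradients of test functions `fₙ` converge in `L₂`, then the `fₙ` converge in `L₆`, and
the limit of the gradients is the weak gradient of the limit. -/
theorem exists_limit_of_tendsto_pd {f : ℕ → E3 → ℝ} (hf : ∀ n, IsTest (f n))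
    {D : Fin 3 → E3 → ℝ} (hD : ∀ j, MemLp (D j) 2 volume)
    (h : ∀ j, Tendsto (fun n => eLpNorm (pd j (f n) - D j) 2 volume) atTop (𝓝 0)) :
    ∃ v, MemLp v 6 volume ∧ Tendsto (fun n => eLpNorm (f n - v) 6 volume) atTop (𝓝 0) ∧
      ∀ j, HasWeakDeriv j v (D j) := by
  obtain ⟨C, hC, hS⟩ := exists_sobolev_const
  have hc : Tendsto (fun q : ℕ × ℕ => eLpNorm (f q.1 - f q.2) 6 volume) atTop (𝓝 0) := by
    have h1 : Tendsto (fun q : ℕ × ℕ => C * ∑ j, eLpNorm (pd j (f q.1) - pd j (f q.2)) 2 volume)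
        atTop (𝓝 0) := by
      have h2 := tendsto_finsetSum Finset.univ fun j _ => cauchy_of_tendsto_eLpNorm (by norm_num)
        (fun n => ((hf n).pd j).1.continuous.aestronglyMeasurable) (hD j).aestronglyMeasurable (h j)
      simpa using ENNReal.Tendsto.const_mul h2 (Or.inr hC)
    refine tendsto_of_tendsto_of_tendsto_of_le_of_le tendsto_const_nhds h1 (fun _ => bot_le) ?_
    intro q
    have := hS _ ((hf q.1).sub (hf q.2))
    simpa only [pd_sub (hf q.1) (hf q.2)] using this
  obtain ⟨v, hv, hl⟩ := exists_tendsto_eLpNorm_of_cauchy (by norm_num)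
    (fun n => (hf n).memLp 6) hc
  have h2 : (2 : ℝ≥0∞) ≤ 6 := by norm_num
  refine ⟨v, hv, hl, fun j => HasWeakDeriv.of_tendsto
    (fun n => hasWeakDeriv_of_isTest (hf n) j) (MemL2loc.of_memLp h2 hv).locallyIntegrable
    (locallyIntegrable_of_memLp_two (hD j))
    (TendstoL1loc.of_tendsto_eLpNorm (by norm_num)
      (fun n => (hf n).1.continuous.aestronglyMeasurable) hv.aestronglyMeasurable hl)
    (TendstoL1loc.of_tendsto_eLpNorm (by norm_num)
      (fun n => ((hf n).pd j).1.continuous.aestronglyMeasurable) (hD j).aestronglyMeasurable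
      (h j))⟩

/-! ### A weighted Poincaré inequality -/

/-- Jensen's inequality for the sixth power. -/
theorem lintegral_pow_six_le {α : Type*} [MeasurableSpace α] (μ : Measure α)
    [IsProbabilityMeasure μ] {F : α → ℝ≥0∞} (hF : AEMeasurable F μ) :
    (∫⁻ x, F x ∂μ) ^ 6 ≤ ∫⁻ x, F x ^ 6 ∂μ := by
  have hpq : Real.HolderConjugate 6 (6 / 5) := by
    rw [Real.holderConjugate_iff]; norm_num
  have h := ENNReal.lintegral_mul_le_Lp_mul_Lq μ hpq hF (aemeasurable_const (b := (1 : ℝ≥0∞)))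
  have e : ∀ x, F x ^ (6 : ℝ) = F x ^ 6 := fun x => by
    rw [← ENNReal.rpow_natCast]; norm_num
  simp only [Pi.mul_apply, mul_one, ENNReal.one_rpow, lintegral_one, measure_univ, e] at h
  calc (∫⁻ x, F x ∂μ) ^ 6 ≤ ((∫⁻ x, F x ^ 6 ∂μ) ^ (1 / (6 : ℝ))) ^ 6 := by gcongr
    _ = ∫⁻ x, F x ^ 6 ∂μ := by
        rw [← ENNReal.rpow_natCast, ← ENNReal.rpow_mul]; norm_num

theorem eLpNorm_six_pow {F : Type*} [NormedAddCommGroup F] (μ : Measure E3) (f : E3 → F) :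
    eLpNorm f 6 μ ^ 6 = ∫⁻ x, ‖f x‖ₑ ^ 6 ∂μ := by
  have h := eLpNorm_nnreal_pow_eq_lintegral (μ := μ) (f := f) (p := 6) (by norm_num)
  have e : ∀ y : ℝ≥0∞, y ^ (((6 : NNReal) : ℝ)) = y ^ 6 := fun y => by
    rw [← ENNReal.rpow_natCast]; norm_num
  simpa only [e, ENNReal.coe_ofNat] using h

/-- Translation by `h` moves a function by at most `‖h‖ ‖∇χ‖₆` in `L₆`. -/
theorem lintegral_translate_sub_le {χ : E3 → ℝ} (hχ : IsTest χ) (h : E3) :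
    ∫⁻ x, ‖χ (x + h) - χ x‖ₑ ^ 6 ≤ ‖h‖ₑ ^ 6 * eLpNorm (fderiv ℝ χ) 6 volume ^ 6 := by
  have hcf : Continuous (fderiv ℝ χ) := hχ.1.continuous_fderiv (by simp)
  have : IsProbabilityMeasure (volume.restrict (Set.Ioc (0 : ℝ) 1)) := ⟨by simp⟩
  have hpt : ∀ x, ‖χ (x + h) - χ x‖ₑ ^ 6
      ≤ ∫⁻ t in Set.Ioc (0 : ℝ) 1, ‖h‖ₑ ^ 6 * ‖fderiv ℝ χ (x + t • h)‖ₑ ^ 6 := by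
    intro x
    have hc : Continuous fun t : ℝ => fderiv ℝ χ (x + t • h) h :=
      (hcf.comp (by fun_prop)).clm_apply continuous_const
    have hftc : ∫ t in (0 : ℝ)..1, fderiv ℝ χ (x + t • h) h = χ (x + h) - χ x := by
      have hd : ∀ t : ℝ, HasDerivAt (fun t : ℝ => χ (x + t • h)) (fderiv ℝ χ (x + t • h) h) t := by
        intro t
        have h1 : HasFDerivAt χ (fderiv ℝ χ (x + t • h)) (x + t • h) :=
          (hχ.1.differentiable (by simp) _).hasFDerivAt
        have h2 : HasDerivAt (fun t : ℝ => x + t • h) h t := by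
          simpa using ((hasDerivAt_id t).smul_const h).const_add x
        exact h1.comp_hasDerivAt t h2
      rw [intervalIntegral.integral_eq_sub_of_hasDerivAt (fun t _ => hd t)
        (hc.intervalIntegrable _ _)]
      simp
    rw [intervalIntegral.integral_of_le zero_le_one] at hftc
    rw [← hftc]
    refine (pow_le_pow_left' (enorm_integral_le_lintegral_enorm _) 6).trans ?_
    refine (lintegral_pow_six_le _ hc.enorm.measurable.aemeasurable).trans ?_
    refine lintegral_mono fun t => ?_
    rw [← mul_pow, mul_comm]
    exact pow_le_pow_left' (ContinuousLinearMap.le_opENorm _ _) 6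
  refine (lintegral_mono hpt).trans ?_
  have hm : Continuous fun q : E3 × ℝ => ‖h‖ₑ ^ 6 * ‖fderiv ℝ χ (q.1 + q.2 • h)‖ₑ ^ 6 :=
    (ENNReal.continuous_const_mul (by simp)).comp
      (ENNReal.continuous_pow 6 |>.comp (hcf.comp (by fun_prop)).enorm)
  rw [lintegral_lintegral_swap hm.measurable.aemeasurable, eLpNorm_six_pow]
  have he : ∀ t : ℝ, ∫⁻ x, ‖h‖ₑ ^ 6 * ‖fderiv ℝ χ (x + t • h)‖ₑ ^ 6
      = ‖h‖ₑ ^ 6 * ∫⁻ x, ‖fderiv ℝ χ x‖ₑ ^ 6 := by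
    intro t
    rw [lintegral_const_mul' _ _ (by simp),
      lintegral_add_right_eq_self (fun x => ‖fderiv ℝ χ x‖ₑ ^ 6) (t • h)]
  simp only [he, lintegral_const, measure_univ, mul_one, le_refl]

/-- The weight `(1 + |x|)⁻¹⁰`. The exponent leaves `|x|⁶ (1 + |x|)⁻¹⁰` integrable on `ℝ³`. -/
noncomputable def weight (x : E3) : ℝ≥0∞ := ENNReal.ofReal ((1 + ‖x‖) ^ (-10 : ℝ))

theorem measurable_weight : Measurable weight := by
  unfold weight; fun_prop

theorem weight_ne_top (x : E3) : weight x ≠ ⊤ := ENNReal.ofReal_ne_top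

theorem weight_mul_le (x h : E3) : weight x * weight (x + h) ≤ weight h := by
  rw [weight, weight, weight, ← ENNReal.ofReal_mul (by positivity),
    ← Real.mul_rpow (by positivity) (by positivity)]
  refine ENNReal.ofReal_le_ofReal
    (Real.rpow_le_rpow_of_nonpos (by positivity) ?_ (by norm_num))
  have h1 : ‖h‖ ≤ ‖x + h‖ + ‖x‖ := by simpa using norm_sub_le (x + h) x
  nlinarith [norm_nonneg x, norm_nonneg (x + h)]

theorem weight_mul_pow_six_le (h : E3) :
    weight h * ‖h‖ₑ ^ 6 ≤ ENNReal.ofReal ((1 + ‖h‖) ^ (-4 : ℝ)) := by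
  rw [weight, ← ofReal_norm, ← ENNReal.ofReal_pow (norm_nonneg _),
    ← ENNReal.ofReal_mul (by positivity)]
  refine ENNReal.ofReal_le_ofReal ?_
  have e : ((1 : ℝ) + ‖h‖) ^ (-4 : ℝ) = (1 + ‖h‖) ^ (-10 : ℝ) * (1 + ‖h‖) ^ 6 := by
    rw [← Real.rpow_natCast, ← Real.rpow_add (by positivity)]; norm_num
  rw [e]
  gcongr
  linarith [norm_nonneg h]

theorem lintegral_weight_ne_top : ∫⁻ x, weight x ≠ ⊤ :=
  (finite_integral_one_add_norm (E := E3) (μ := volume) (r := 10) (by simp; norm_num)).ne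

theorem weight_pos (x : E3) : 0 < weight x := by
  rw [weight, ENNReal.ofReal_pos]; positivity

theorem lintegral_weight_ne_zero : ∫⁻ x, weight x ≠ 0 := by
  intro h
  rw [lintegral_eq_zero_iff measurable_weight] at h
  obtain ⟨x, hx⟩ := h.exists
  exact (weight_pos x).ne' hx

/-- The probability measure on `ℝ³` with density proportional to `(1 + |x|)⁻¹⁰`. -/
noncomputable def weightMeasure : Measure E3 := (∫⁻ x, weight x)⁻¹ • volume.withDensity weight

instance : IsProbabilityMeasure weightMeasure := ⟨by
  rw [weightMeasure, Measure.smul_apply, withDensity_apply _ MeasurableSet.univ,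
    Measure.restrict_univ, smul_eq_mul,
    ENNReal.inv_mul_cancel lintegral_weight_ne_zero lintegral_weight_ne_top]⟩

theorem lintegral_weightMeasure {f : E3 → ℝ≥0∞} (hf : Measurable f) :
    ∫⁻ x, f x ∂weightMeasure = (∫⁻ x, weight x)⁻¹ * ∫⁻ x, weight x * f x := by
  rw [weightMeasure, lintegral_smul_measure, lintegral_withDensity_eq_lintegral_mul _
    measurable_weight hf]
  rfl

theorem exists_restrict_le_smul_weightMeasure {K : Set E3} (hK : IsCompact K) :
    ∃ C : ℝ≥0∞, C ≠ ⊤ ∧ volume.restrict K ≤ C • weightMeasure := by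
  obtain ⟨r, hr⟩ := hK.isBounded.subset_closedBall (0 : E3)
  set c : ℝ≥0∞ := ENNReal.ofReal ((1 + |r|) ^ (-10 : ℝ)) with hc
  have hc0 : c ≠ 0 := by
    rw [hc, ← pos_iff_ne_zero, ENNReal.ofReal_pos]; positivity
  have hcK : ∀ x ∈ K, c ≤ weight x := by
    intro x hx
    have h1 : ‖x‖ ≤ |r| := (by simpa using hr hx : ‖x‖ ≤ r).trans (le_abs_self r)
    exact ENNReal.ofReal_le_ofReal
      (Real.rpow_le_rpow_of_nonpos (by positivity) (by linarith) (by norm_num))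
  refine ⟨c⁻¹ * ∫⁻ x, weight x,
    ENNReal.mul_ne_top (ENNReal.inv_ne_top.2 hc0) lintegral_weight_ne_top, ?_⟩
  rw [weightMeasure, smul_smul, mul_assoc,
    ENNReal.mul_inv_cancel lintegral_weight_ne_zero lintegral_weight_ne_top, mul_one]
  refine Measure.le_iff.2 fun s hs => ?_
  rw [Measure.restrict_apply hs, Measure.smul_apply, smul_eq_mul,
    withDensity_apply _ hs, mul_comm, ← div_eq_mul_inv, ENNReal.le_div_iff_mul_le (Or.inl hc0)
      (Or.inl ENNReal.ofReal_ne_top), mul_comm, ← setLIntegral_const]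
  exact (setLIntegral_mono' (hs.inter hK.measurableSet) fun x hx => hcK x hx.2).trans
    (lintegral_mono_set Set.inter_subset_left)

/-- Integrating `|χ(x + h) - χ(x)|⁶` against the weights at `x` and `x + h`, whose product is at
most the weight at `h`, bounds the double integral of the differences by the gradient. -/
theorem lintegral_lintegral_sub_le {χ : E3 → ℝ} (hχ : IsTest χ) :
    ∫⁻ x, weight x * ∫⁻ y, weight y * ‖χ x - χ y‖ₑ ^ 6
      ≤ (∫⁻ h : E3, ENNReal.ofReal ((1 + ‖h‖) ^ (-4 : ℝ)))
        * eLpNorm (fderiv ℝ χ) 6 volume ^ 6 := by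
  have hcχ := hχ.1.continuous
  have h2 : ∀ x, weight x * ∫⁻ y, weight y * ‖χ x - χ y‖ₑ ^ 6
      ≤ ∫⁻ h, weight h * ‖χ (x + h) - χ x‖ₑ ^ 6 := by
    intro x
    rw [← lintegral_add_left_eq_self (fun y => weight y * ‖χ x - χ y‖ₑ ^ 6) x,
      ← lintegral_const_mul' _ _ (weight_ne_top x)]
    refine lintegral_mono fun h => ?_
    rw [← mul_assoc, ← neg_sub (χ (x + h)), enorm_neg]
    exact mul_le_mul_left (weight_mul_le x h) _
  have hw : Measurable fun q : E3 × E3 => weight q.2 := measurable_weight.comp measurable_snd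
  have hd : Continuous fun q : E3 × E3 => ‖χ (q.1 + q.2) - χ q.1‖ₑ ^ 6 :=
    (ENNReal.continuous_pow 6).comp (by fun_prop)
  refine (lintegral_mono h2).trans ?_
  rw [lintegral_lintegral_swap (hw.mul hd.measurable).aemeasurable,
    ← lintegral_mul_const _ (by fun_prop)]
  refine lintegral_mono fun h => ?_
  rw [lintegral_const_mul' _ _ (weight_ne_top h)]
  refine (mul_le_mul_right (lintegral_translate_sub_le hχ h) _).trans ?_
  rw [← mul_assoc]
  exact mul_le_mul_left (weight_mul_pow_six_le h) _

theorem lintegral_sub_integral_weightMeasure_le {χ : E3 → ℝ} (hχ : IsTest χ) :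
    ∫⁻ x, ‖χ x - ∫ y, χ y ∂weightMeasure‖ₑ ^ 6 ∂weightMeasure
      ≤ ∫⁻ x, ∫⁻ y, ‖χ x - χ y‖ₑ ^ 6 ∂weightMeasure ∂weightMeasure := by
  have hcχ := hχ.1.continuous
  have hint : Integrable χ weightMeasure :=
    ((hcχ.memLp_of_hasCompactSupport hχ.2 : MemLp χ 1 weightMeasure)).integrable le_rfl
  refine lintegral_mono fun x => ?_
  have e : χ x - ∫ y, χ y ∂weightMeasure = ∫ y, (χ x - χ y) ∂weightMeasure := by
    rw [integral_sub (integrable_const _) hint]; simp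
  rw [e]
  refine (pow_le_pow_left' (enorm_integral_le_lintegral_enorm _) 6).trans ?_
  exact lintegral_pow_six_le _ (by fun_prop)

/-- Poincaré's inequality `‖χ - ∫ χ dν‖_{L₆(ν)} ≤ C ‖∇χ‖₆` for the weighted measure `ν`. -/
theorem exists_poincare_const : ∃ C : ℝ≥0∞, C ≠ ⊤ ∧ ∀ χ : E3 → ℝ, IsTest χ →
    eLpNorm (fun x => χ x - ∫ y, χ y ∂weightMeasure) 6 weightMeasure
      ≤ C * eLpNorm (fderiv ℝ χ) 6 volume := by
  set Z : ℝ≥0∞ := ∫⁻ x, weight x with hZ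
  set M : ℝ≥0∞ := ∫⁻ h : E3, ENNReal.ofReal ((1 + ‖h‖) ^ (-4 : ℝ)) with hM
  have hMtop : M ≠ ⊤ :=
    (finite_integral_one_add_norm (E := E3) (μ := volume) (r := 4) (by simp; norm_num)).ne
  have hZi : Z⁻¹ ≠ ⊤ := ENNReal.inv_ne_top.2 lintegral_weight_ne_zero
  set L : ℝ≥0∞ := Z⁻¹ * (Z⁻¹ * M) with hL
  have hLtop : L ≠ ⊤ := ENNReal.mul_ne_top hZi (ENNReal.mul_ne_top hZi hMtop)
  refine ⟨L ^ (1 / (6 : ℝ)), ENNReal.rpow_ne_top_of_nonneg (by norm_num) hLtop, fun χ hχ => ?_⟩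
  have hcχ := hχ.1.continuous
  have hFm : Measurable fun q : E3 × E3 => ‖χ q.1 - χ q.2‖ₑ ^ 6 :=
    ((ENNReal.continuous_pow 6).comp (by fun_prop : Continuous fun q : E3 × E3 =>
      ‖χ q.1 - χ q.2‖ₑ)).measurable
  have hdouble : ∫⁻ x, ∫⁻ y, ‖χ x - χ y‖ₑ ^ 6 ∂weightMeasure ∂weightMeasure
      = Z⁻¹ * (Z⁻¹ * ∫⁻ x, weight x * ∫⁻ y, weight y * ‖χ x - χ y‖ₑ ^ 6) := by
    rw [lintegral_weightMeasure (Measurable.lintegral_prod_right' hFm)]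
    congr 1
    rw [← lintegral_const_mul' _ _ hZi]
    refine lintegral_congr fun x => ?_
    have hx : Measurable fun y => ‖χ x - χ y‖ₑ ^ 6 :=
      ((ENNReal.continuous_pow 6).comp (by fun_prop : Continuous fun y => ‖χ x - χ y‖ₑ)).measurable
    rw [lintegral_weightMeasure hx, mul_left_comm]
  have hpow : eLpNorm (fun x => χ x - ∫ y, χ y ∂weightMeasure) 6 weightMeasure ^ 6
      ≤ L * eLpNorm (fderiv ℝ χ) 6 volume ^ 6 := by
    rw [eLpNorm_six_pow]
    refine (lintegral_sub_integral_weightMeasure_le hχ).trans ?_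
    rw [hdouble, hL, mul_assoc, mul_assoc]
    exact mul_le_mul_right (mul_le_mul_right (lintegral_lintegral_sub_le hχ) _) _
  have hroot : L = (L ^ (1 / (6 : ℝ))) ^ 6 := by
    rw [← ENNReal.rpow_natCast, ← ENNReal.rpow_mul]; norm_num
  rw [hroot, ← mul_pow] at hpow
  exact (ENNReal.pow_le_pow_left_iff (by norm_num)).1 hpow

/-- If the Hessians of test functions converge in `L₂`, then the limit is the weak Hessian of a
function in `L_{2,loc}` with weak gradient in `L₆`. -/
theorem exists_limit_of_tendsto_hessian {χ : ℕ → E3 → ℝ} (hχ : ∀ n, IsTest (χ n))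
    {g : Fin 3 → Fin 3 → E3 → ℝ} (hg : ∀ i j, MemLp (g i j) 2 volume)
    (h : ∀ i j, Tendsto (fun n => eLpNorm (pd j (pd i (χ n)) - g i j) 2 volume) atTop (𝓝 0)) :
    ∃ (φ : E3 → ℝ) (v : Fin 3 → E3 → ℝ), MemL2loc φ ∧ (∀ i, MemL2loc (v i)) ∧
      (∀ i, HasWeakDeriv i φ (v i)) ∧ ∀ i j, HasWeakDeriv j (v i) (g i j) := by
  choose v hv hvl hvw using fun i => exists_limit_of_tendsto_pd (fun n => (hχ n).pd i) (hg i) (h i)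
  obtain ⟨C, hC, hP⟩ := exists_poincare_const
  set c : ℕ → ℝ := fun n => ∫ y, χ n y ∂weightMeasure with hc
  set f : ℕ → E3 → ℝ := fun n x => χ n x - c n with hf
  have hfc : ∀ n, Continuous (f n) := fun n => (hχ n).1.continuous.sub continuous_const
  have hint : ∀ n, Integrable (χ n) weightMeasure := fun n =>
    ((hχ n).1.continuous.memLp_of_hasCompactSupport (hχ n).2 :
      MemLp (χ n) 1 weightMeasure).integrable le_rfl
  have hfL : ∀ n, MemLp (f n) 6 weightMeasure := fun n =>
    ((hχ n).1.continuous.memLp_of_hasCompactSupport (hχ n).2).sub (memLp_const _)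
  have hcau : Tendsto (fun q : ℕ × ℕ => eLpNorm (f q.1 - f q.2) 6 weightMeasure) atTop (𝓝 0) := by
    have h1 : Tendsto (fun q : ℕ × ℕ => C * ∑ j, eLpNorm (pd j (χ q.1) - pd j (χ q.2)) 6 volume)
        atTop (𝓝 0) := by
      have h2 := tendsto_finsetSum Finset.univ fun j _ => cauchy_of_tendsto_eLpNorm (by norm_num)
        (fun n => ((hχ n).pd j).1.continuous.aestronglyMeasurable) (hv j).aestronglyMeasurable
        (hvl j)
      simpa using ENNReal.Tendsto.const_mul h2 (Or.inr hC)
    refine tendsto_of_tendsto_of_tendsto_of_le_of_le tendsto_const_nhds h1 (fun _ => bot_le) ?_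
    intro q
    have ht := (hχ q.1).sub (hχ q.2)
    have e : f q.1 - f q.2 = fun x => (χ q.1 - χ q.2) x
        - ∫ y, (χ q.1 - χ q.2) y ∂weightMeasure := by
      funext x
      simp only [hf, hc, Pi.sub_apply]
      rw [integral_sub (hint _) (hint _)]
      ring
    simp only [e]
    refine (hP _ ht).trans ?_
    gcongr
    refine (eLpNorm_fderiv_le_sum_pd ht (by norm_num)).trans ?_
    simp only [pd_sub (hχ q.1) (hχ q.2), le_refl]
  obtain ⟨φ, hφ, hlim⟩ := exists_tendsto_eLpNorm_of_cauchy (by norm_num) hfL hcau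
  have h26 : (2 : ℝ≥0∞) ≤ 6 := by norm_num
  have hφl : MemL2loc φ := by
    intro K hK
    obtain ⟨B, hB, hle⟩ := exists_restrict_le_smul_weightMeasure hK
    exact (hφ.mono_exponent h26).of_measure_le_smul hB hle
  have hloc : TendstoL1loc f φ := by
    intro K hK
    obtain ⟨B, hB, hle⟩ := exists_restrict_le_smul_weightMeasure hK
    have h0 := ENNReal.Tendsto.const_mul hlim (Or.inr hB)
    rw [mul_zero] at h0
    refine tendsto_of_tendsto_of_tendsto_of_le_of_le tendsto_const_nhds h0 (fun _ => bot_le) ?_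
    intro n
    calc eLpNorm (f n - φ) 1 (volume.restrict K) ≤ B * eLpNorm (f n - φ) 1 weightMeasure := by
          rw [eLpNorm_one_eq_lintegral_enorm, eLpNorm_one_eq_lintegral_enorm,
            ← smul_eq_mul, ← lintegral_smul_measure]
          exact lintegral_mono' hle le_rfl
      _ ≤ B * eLpNorm (f n - φ) 6 weightMeasure := by
          gcongr
          exact eLpNorm_le_eLpNorm_of_exponent_le (by norm_num)
            ((hfL n).sub hφ).aestronglyMeasurable
  have hvloc : ∀ i, MemL2loc (v i) := fun i => MemL2loc.of_memLp h26 (hv i)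
  refine ⟨φ, v, hφl, hvloc, fun i => HasWeakDeriv.of_tendsto (f := f) (g := fun n => pd i (χ n))
    (fun n => ?_) hφl.locallyIntegrable (hvloc i).locallyIntegrable hloc
    (TendstoL1loc.of_tendsto_eLpNorm (by norm_num)
      (fun n => ((hχ n).pd i).1.continuous.aestronglyMeasurable) (hv i).aestronglyMeasurable
      (hvl i)), hvw⟩
  have := (hasWeakDeriv_of_isTest (hχ n) i).sub (hasWeakDeriv_const (c n) i)
  rw [sub_zero] at this
  exact this

/-! ### Orthogonal projection in `L₂` -/

/-- Orthogonal projection of a tuple of `L₂` functions onto the closure of a space of tuples. -/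
theorem exists_orthogonal_decomposition {ι : Type*} [Fintype ι]
    (T : Submodule ℝ (ι → E3 → ℝ)) (hT : ∀ t ∈ T, ∀ i, MemLp (t i) 2 volume)
    {g : ι → E3 → ℝ} (hg : ∀ i, MemLp (g i) 2 volume) :
    ∃ (t : ℕ → ι → E3 → ℝ) (z : ι → E3 → ℝ), (∀ n, t n ∈ T) ∧ (∀ i, MemLp (z i) 2 volume) ∧
      (∀ i, Tendsto (fun n => eLpNorm (t n i - z i) 2 volume) atTop (𝓝 0)) ∧
      ∀ s ∈ T, ∑ i, ∫ x, (g i - z i) x * s i x = 0 := by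
  -- closures and projections are taken in the Hilbert sum of copies of `L₂`
  let H := PiLp 2 fun _ : ι => Lp ℝ 2 (volume : Measure E3)
  let J : T →ₗ[ℝ] H :=
    { toFun := fun t => WithLp.toLp 2 fun i => (hT t.1 t.2 i).toLp (t.1 i)
      map_add' := fun s t => by ext1 i; rfl
      map_smul' := fun c t => by ext1 i; rfl }
  let K : Submodule ℝ H := (LinearMap.range J).topologicalClosure
  have hKc : IsClosed (K : Set H) := Submodule.isClosed_topologicalClosure _
  have : CompleteSpace K := hKc.completeSpace_coe
  let G : H := WithLp.toLp 2 fun i => (hg i).toLp (g i)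
  let P : H := K.starProjection G
  have hPK : P ∈ closure (LinearMap.range J : Set H) :=
    (K.starProjection_apply_mem G : K.starProjection G ∈ K)
  obtain ⟨y, hy, hyl⟩ := mem_closure_iff_seq_limit.1 hPK
  choose t ht using fun n => (hy n : y n ∈ LinearMap.range J)
  refine ⟨fun n => (t n).1, fun i => P i, fun n => (t n).2, fun i => Lp.memLp _, fun i => ?_,
    fun s hs => ?_⟩
  · have h1 : Tendsto (fun n => y n i) atTop (𝓝 (P i)) :=
      ((PiLp.continuous_apply 2 (fun _ : ι => Lp ℝ 2 (volume : Measure E3)) i).tendsto P).comp hyl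
    have h2 : ∀ n, y n i = (hT _ (t n).2 i).toLp ((t n).1 i) := fun n => by rw [← ht n]; rfl
    simp only [h2] at h1
    have h3 : Tendsto (fun n => (hT _ (t n).2 i).toLp ((t n).1 i)) atTop
        (𝓝 ((Lp.memLp (P i)).toLp (P i))) := by rwa [Lp.toLp_coeFn]
    exact (Lp.tendsto_Lp_iff_tendsto_eLpNorm'' _ (fun n => hT _ (t n).2 i) _ (Lp.memLp (P i))).1 h3
  · have h1 : inner ℝ (G - P) (J ⟨s, hs⟩) = (0 : ℝ) := by
      refine Submodule.starProjection_inner_eq_zero (K := K) G _ ?_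
      exact Submodule.le_topologicalClosure _ (LinearMap.mem_range_self J _)
    rw [PiLp.inner_apply] at h1
    rw [← h1]
    refine Finset.sum_congr rfl fun i _ => ?_
    rw [L2.inner_def]
    refine integral_congr_ae ?_
    have e1 := (hg i).coeFn_toLp
    have e2 := (hT s hs i).coeFn_toLp
    have e3 := Lp.coeFn_sub ((hg i).toLp (g i)) (P i)
    filter_upwards [e1, e2, e3] with x h1 h2 h3
    have e4 : (G - P) i = (hg i).toLp (g i) - P i := rfl
    have e5 : (J ⟨s, hs⟩) i = (hT s hs i).toLp (s i) := rfl
    rw [e4, e5, h2, h3]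
    simp [h1, mul_comm]

/-- Projection of a matrix field onto the closure of the Hessians of test functions. -/
theorem exists_hessian_decomposition {g : Fin 3 → Fin 3 → E3 → ℝ}
    (hg : ∀ i j, MemLp (g i j) 2 volume) :
    ∃ (χ : ℕ → E3 → ℝ) (z : Fin 3 → Fin 3 → E3 → ℝ), (∀ n, IsTest (χ n)) ∧
      (∀ i j, MemLp (z i j) 2 volume) ∧
      (∀ i j, Tendsto (fun n => eLpNorm (pd j (pd i (χ n)) - z i j) 2 volume) atTop (𝓝 0)) ∧
      ∀ χ, IsTest χ → ∑ i, ∑ j, ∫ x, (g i j - z i j) x * pd j (pd i χ) x = 0 := by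
  let T : Submodule ℝ (Fin 3 × Fin 3 → E3 → ℝ) :=
    { carrier := {t | ∃ χ, IsTest χ ∧ t = fun p => pd p.2 (pd p.1 χ)}
      zero_mem' := ⟨0, IsTest.zero, by funext p; simp [pd_zero]⟩
      add_mem' := by
        rintro _ _ ⟨χ, h, rfl⟩ ⟨χ', h', rfl⟩
        exact ⟨χ + χ', h.add h', by
          funext p; simp [pd_add h h', pd_add (h.pd _) (h'.pd _)]⟩
      smul_mem' := by
        rintro c _ ⟨χ, h, rfl⟩
        exact ⟨c • χ, h.smul c, by funext p; simp [pd_smul c h, pd_smul c (h.pd _)]⟩ }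
  obtain ⟨t, z, ht, hz, hl, ho⟩ := exists_orthogonal_decomposition T
    (by rintro _ ⟨χ, h, rfl⟩ p; exact ((h.pd _).pd _).memLp 2) (g := fun p => g p.1 p.2)
    (fun p => hg _ _)
  choose χ hχ hχt using ht
  refine ⟨χ, fun i j => z (i, j), hχ, fun i j => hz _, fun i j => ?_, fun ξ hξ => ?_⟩
  · have := hl (i, j)
    simpa only [hχt] using this
  · have := ho _ ⟨ξ, hξ, rfl⟩
    rwa [Fintype.sum_prod_type] at this

/-- Projection of a matrix field onto the closure of the gradients of solenoidal test fields. -/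
theorem exists_solenoidal_decomposition {g : Fin 3 → Fin 3 → E3 → ℝ}
    (hg : ∀ i j, MemLp (g i j) 2 volume) :
    ∃ (ψ : ℕ → Fin 3 → E3 → ℝ) (z : Fin 3 → Fin 3 → E3 → ℝ), (∀ n, IsSolenoidalTest (ψ n)) ∧
      (∀ i j, MemLp (z i j) 2 volume) ∧
      (∀ i j, Tendsto (fun n => eLpNorm (pd j (ψ n i) - z i j) 2 volume) atTop (𝓝 0)) ∧
      ∀ ψ, IsSolenoidalTest ψ → ∑ i, ∑ j, ∫ x, (g i j - z i j) x * pd j (ψ i) x = 0 := by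
  let T : Submodule ℝ (Fin 3 × Fin 3 → E3 → ℝ) :=
    { carrier := {t | ∃ ψ, IsSolenoidalTest ψ ∧ t = fun p => pd p.2 (ψ p.1)}
      zero_mem' := ⟨0, IsSolenoidalTest.zero, by funext p; simp [pd_zero]⟩
      add_mem' := by
        rintro _ _ ⟨ψ, h, rfl⟩ ⟨ψ', h', rfl⟩
        exact ⟨ψ + ψ', h.add h', by funext p; simp [pd_add (h.1 _) (h'.1 _)]⟩
      smul_mem' := by
        rintro c _ ⟨ψ, h, rfl⟩
        exact ⟨c • ψ, h.smul c, by funext p; simp [pd_smul c (h.1 _)]⟩ }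
  obtain ⟨t, z, ht, hz, hl, ho⟩ := exists_orthogonal_decomposition T
    (by rintro _ ⟨ψ, h, rfl⟩ p; exact ((h.1 _).pd _).memLp 2) (g := fun p => g p.1 p.2)
    (fun p => hg _ _)
  choose ψ hψ hψt using ht
  refine ⟨ψ, fun i j => z (i, j), hψ, fun i j => hz _, fun i j => ?_, fun ξ hξ => ?_⟩
  · have := hl (i, j)
    simpa only [hψt] using this
  · have := ho _ ⟨ξ, hξ, rfl⟩
    rwa [Fintype.sum_prod_type] at this

/-! ### Matrix fields with curl-free rows -/

/-- `∂ₖ rᵢⱼ = ∂ⱼ rᵢₖ` in the sense of distributions: every row of `r` is curl-free. -/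
def RowCurlFree (r : Fin 3 → Fin 3 → E3 → ℝ) : Prop :=
  ∀ i j k, ∀ χ, IsTest χ → ∫ x, r i j x * pd k χ x = ∫ x, r i k x * pd j χ x

theorem rowCurlFree_of_hasWeakDeriv {W : Fin 3 → E3 → ℝ} {r : Fin 3 → Fin 3 → E3 → ℝ}
    (h : ∀ i j, HasWeakDeriv j (W i) (r i j)) : RowCurlFree r := by
  intro i j k χ hχ
  have h1 := (h i j).2.2 _ (hχ.pd k)
  have h2 := (h i k).2.2 _ (hχ.pd j)
  rw [pd_comm hχ.1 j k] at h1
  linarith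

theorem rowCurlFree_of_hasWeakDeriv2 {f : E3 → ℝ} {r : Fin 3 → Fin 3 → E3 → ℝ}
    (h : ∀ i j, HasWeakDeriv2 i j f (r i j)) : RowCurlFree r := by
  intro i j k χ hχ
  have h1 := (h i j).2.2 _ (hχ.pd k)
  have h2 := (h i k).2.2 _ (hχ.pd j)
  rw [pd_comm hχ.1 j k] at h1
  rw [← h1, ← h2]

theorem integral_mul_lap {f χ : E3 → ℝ} (hf : LocallyIntegrable f) (hχ : IsTest χ) :
    ∫ x, f x * lap χ x = ∑ k, ∫ x, f x * pd k (pd k χ) x := by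
  simp only [lap, Finset.sum_apply, Finset.mul_sum]
  exact integral_finsetSum _ fun k _ => integrable_mul_test hf ((hχ.pd k).pd k)

theorem integral_sum_mul {ι : Type*} [Fintype ι] {f : ι → E3 → ℝ} {ψ : E3 → ℝ}
    (hf : ∀ i, LocallyIntegrable (f i)) (hψ : IsTest ψ) :
    ∫ x, (∑ i, f i) x * ψ x = ∑ i, ∫ x, f i x * ψ x := by
  simp only [Finset.sum_apply, Finset.sum_mul]
  exact integral_finsetSum _ fun i _ => integrable_mul_test (hf i) hψ

theorem memLp_sum {f : Fin 3 → E3 → ℝ} (hf : ∀ i, MemLp (f i) 2 volume) :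
    MemLp (∑ i, f i) 2 volume := by
  have := memLp_finsetSum Finset.univ fun i _ => hf i
  convert this using 1
  funext x; simp

section
variable {r : Fin 3 → Fin 3 → E3 → ℝ}

/-- A field with curl-free rows that is orthogonal to all Hessians has harmonic, hence vanishing,
trace. -/
theorem RowCurlFree.trace_eq_zero (hc : RowCurlFree r) (hr : ∀ i j, MemLp (r i j) 2 volume)
    (ho : ∀ χ, IsTest χ → ∑ i, ∑ j, ∫ x, r i j x * pd j (pd i χ) x = 0) :
    ∑ i, r i i =ᵐ[volume] 0 := by
  have hl : ∀ i j, LocallyIntegrable (r i j) := fun i j => locallyIntegrable_of_memLp_two (hr i j)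
  refine ae_zero_of_integral_mul_lap_eq_zero (memLp_sum fun i => hr i i) fun χ hχ => ?_
  rw [integral_sum_mul (fun i => hl i i) hχ.lap, ← ho χ hχ]
  refine Finset.sum_congr rfl fun i _ => ?_
  rw [integral_mul_lap (hl i i) hχ]
  refine Finset.sum_congr rfl fun k _ => ?_
  rw [hc i i k _ (hχ.pd k), pd_comm hχ.1]

/-- The vector field `f e_a`. -/
def axisField (a : Fin 3) (f : E3 → ℝ) : Fin 3 → E3 → ℝ := Pi.single a f

@[simp] theorem axisField_same (a : Fin 3) (f : E3 → ℝ) : axisField a f a = f :=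
  Pi.single_eq_same _ _

theorem axisField_of_ne {a i : Fin 3} (h : i ≠ a) (f : E3 → ℝ) : axisField a f i = 0 :=
  Pi.single_eq_of_ne h _

theorem isTest_axisField {f : E3 → ℝ} (hf : IsTest f) (a i : Fin 3) : IsTest (axisField a f i) := by
  rcases eq_or_ne i a with rfl | h
  · simpa using hf
  · simpa [axisField_of_ne h] using IsTest.zero

/-- The field `∂_bχ e_a - ∂_aχ e_b`, divergence free because partial derivatives commute. -/
theorem isSolenoidalTest_rotated_gradient {χ : E3 → ℝ} (hχ : IsTest χ) (a b : Fin 3) :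
    IsSolenoidalTest (axisField a (pd b χ) - axisField b (pd a χ)) := by
  have hs : ∀ a b i, IsTest (axisField a (pd b χ) i) := fun a b => isTest_axisField (hχ.pd b) a
  refine ⟨fun i => (hs a b i).sub (hs b a i), fun x => ?_⟩
  have hd : ∀ a b, ∑ i, pd i (axisField a (pd b χ) i) x
      = pd a (pd b χ) x := by
    intro a b
    rw [Finset.sum_eq_single a (fun i _ hi => by simp [axisField_of_ne hi, pd_zero]) (by simp)]
    simp
  simp only [Pi.sub_apply]
  simp only [pd_sub (hs _ _ _) (hs _ _ _), Pi.sub_apply, Finset.sum_sub_distrib, hd,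
    pd_comm hχ.1 a b, sub_self]

/-- A field with curl-free rows that is orthogonal to the gradients of solenoidal test fields is
symmetric: `r_ab - r_ba` is harmonic. -/
theorem RowCurlFree.symm_of_orthogonal (hc : RowCurlFree r) (hr : ∀ i j, MemLp (r i j) 2 volume)
    (ho : ∀ ψ, IsSolenoidalTest ψ → ∑ i, ∑ j, ∫ x, r i j x * pd j (ψ i) x = 0) (a b : Fin 3) :
    r a b =ᵐ[volume] r b a := by
  have hl : ∀ i j, LocallyIntegrable (r i j) := fun i j => locallyIntegrable_of_memLp_two (hr i j)
  have h0 : r a b - r b a =ᵐ[volume] 0 := by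
    refine ae_zero_of_integral_mul_lap_eq_zero ((hr a b).sub (hr b a)) fun χ hχ => ?_
    have h1 := ho _ (isSolenoidalTest_rotated_gradient hχ a b)
    have hs : ∀ a b i, IsTest (axisField a (pd b χ) i) := fun a b => isTest_axisField (hχ.pd b) a
    have h2 : ∀ a b, ∑ i, ∑ j, ∫ x, r i j x * pd j (axisField a (pd b χ) i) x
        = ∫ x, r a b x * lap χ x := by
      intro a b
      rw [Finset.sum_eq_single a (fun i _ hi => by simp [axisField_of_ne hi, pd_zero]) (by simp),
        integral_mul_lap (hl a b) hχ]
      refine Finset.sum_congr rfl fun j _ => ?_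
      rw [axisField_same, pd_comm hχ.1, hc a j b _ (hχ.pd j)]
    have h3 : ∀ i j, ∫ x, r i j x * pd j ((axisField a (pd b χ)
        - axisField b (pd a χ)) i) x
        = (∫ x, r i j x * pd j (axisField a (pd b χ) i) x)
          - ∫ x, r i j x * pd j (axisField b (pd a χ) i) x := by
      intro i j
      rw [Pi.sub_apply, pd_sub (hs _ _ _) (hs _ _ _),
        ← integral_sub (integrable_mul_test (hl i j) ((hs _ _ _).pd j))
          (integrable_mul_test (hl i j) ((hs _ _ _).pd j))]
      simp only [Pi.sub_apply, mul_sub]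
    simp only [h3, Finset.sum_sub_distrib, h2] at h1
    rw [← h1, ← integral_sub (integrable_mul_test (hl a b) hχ.lap)
      (integrable_mul_test (hl b a) hχ.lap)]
    simp only [Pi.sub_apply, sub_mul]
  filter_upwards [h0] with x hx
  simpa [sub_eq_zero] using hx

/-- A symmetric trace-free `L₂` field with curl-free rows is harmonic, hence zero. -/
theorem RowCurlFree.eq_zero_of_symm_of_trace (hc : RowCurlFree r)
    (hr : ∀ i j, MemLp (r i j) 2 volume) (hs : ∀ i j, r i j =ᵐ[volume] r j i)
    (ht : ∑ i, r i i =ᵐ[volume] 0) (i j : Fin 3) : r i j =ᵐ[volume] 0 := by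
  have hl : ∀ i j, LocallyIntegrable (r i j) := fun i j => locallyIntegrable_of_memLp_two (hr i j)
  refine ae_zero_of_integral_mul_lap_eq_zero (hr i j) fun χ hχ => ?_
  have h1 : ∀ k, ∫ x, r i j x * pd k (pd k χ) x = ∫ x, r k k x * pd i (pd j χ) x := by
    intro k
    rw [hc i j k _ (hχ.pd k), pd_comm hχ.1, ← hc k i k _ (hχ.pd j)]
    refine integral_congr_ae ?_
    filter_upwards [hs i k] with x hx
    rw [hx]
  rw [integral_mul_lap (hl i j) hχ, Finset.sum_congr rfl fun k _ => h1 k,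
    ← integral_sum_mul (fun k => hl k k) ((hχ.pd j).pd i)]
  rw [integral_eq_zero_of_ae]
  filter_upwards [ht] with x hx
  rw [hx]; simp

end

/-! ### The gradient of a function in `BL²` -/

theorem memL2loc_const (c : ℝ) : MemL2loc fun _ => c := fun K hK => by
  have : IsFiniteMeasure (volume.restrict K) := ⟨by simpa using hK.measure_lt_top⟩
  exact memLp_const c

theorem const_mem_BL (c : ℝ) : (fun _ : E3 => c) ∈ BL :=
  ⟨memL2loc_const c, fun i => ⟨0, MemLp.zero, hasWeakDeriv_const c i⟩⟩

theorem HasWeakDeriv2.congr_right {i j : Fin 3} {f g g' : E3 → ℝ} (h : HasWeakDeriv2 i j f g)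
    (hg : g =ᵐ[volume] g') : HasWeakDeriv2 i j f g' := by
  refine ⟨h.1, h.2.1.congr hg, fun ψ hψ => ?_⟩
  rw [h.2.2 ψ hψ]
  exact integral_congr_ae (by filter_upwards [hg] with x hx; rw [hx])

/-- A function in `BL²` has weak first derivatives, and they belong to `BL`. Up to an affine
function it is the limit of test functions given by projecting its Hessian onto the closure of
the Hessians of test functions. -/
theorem exists_hasWeakDeriv_of_mem_BL2 {φ : E3 → ℝ} (hφ : φ ∈ BL2) :
    ∃ v : Fin 3 → BL, ∀ i, HasWeakDeriv i φ (v i) := by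
  choose g hg hw using hφ.2
  obtain ⟨χ, z, hχ, hz, hl, ho⟩ := exists_hessian_decomposition hg
  obtain ⟨φ₀, v, -, hv, hφv, hvz⟩ := exists_limit_of_tendsto_hessian hχ hz hl
  set r : Fin 3 → Fin 3 → E3 → ℝ := fun i j => g i j - z i j with hr
  have hrw : ∀ i j, HasWeakDeriv2 i j (φ - φ₀) (r i j) := fun i j =>
    (hw i j).sub (HasWeakDeriv2.of_hasWeakDeriv (hφv i) (hvz i j))
  have hrL : ∀ i j, MemLp (r i j) 2 volume := fun i j => (hg i j).sub (hz i j)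
  have hrc : RowCurlFree r := rowCurlFree_of_hasWeakDeriv2 hrw
  have hrs : ∀ i j, r i j =ᵐ[volume] r j i := fun i j =>
    ae_eq_of_integral_mul_test (hrw i j).2.1 (hrw j i).2.1 fun ψ hψ => by
      rw [← (hrw i j).2.2 ψ hψ, ← (hrw j i).2.2 ψ hψ, pd_comm hψ.1]
  have hr0 := hrc.eq_zero_of_symm_of_trace hrL hrs (hrc.trace_eq_zero hrL ho)
  obtain ⟨b, a, hab⟩ := ae_affine_of_hasWeakDeriv2_zero fun i j =>
    (hrw i j).congr_right (hr0 i j)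
  refine ⟨fun i => ⟨v i + fun _ => a i, BL.add_mem
    ⟨hv i, fun j => ⟨z i j, hz i j, hvz i j⟩⟩ (const_mem_BL (a i))⟩, fun i => ?_⟩
  refine ((hφv i).add (hasWeakDeriv_affine b a i)).congr ?_ EventuallyEq.rfl
  filter_upwards [hab] with x hx
  rw [Pi.add_apply, ← hx, Pi.sub_apply, add_sub_cancel]

theorem represents_mk (v : Fin 3 → BL) : Represents v fun i => Submodule.Quotient.mk (v i) :=
  fun _ => rfl

theorem mk_eq_mk_of_ae {v w : BL} {c : ℝ} (h : ∀ᵐ x, (v : E3 → ℝ) x - (w : E3 → ℝ) x = c) :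
    (Submodule.Quotient.mk v : BLdot) = Submodule.Quotient.mk w := by
  rw [Submodule.Quotient.eq]
  exact ⟨c, h⟩

theorem Represents.ae_sub_const {v w : Fin 3 → BL} {U : BLdot3} (hv : Represents v U)
    (hw : Represents w U) (i : Fin 3) :
    ∃ c : ℝ, ∀ᵐ x, (v i : E3 → ℝ) x - (w i : E3 → ℝ) x = c := by
  have h := (hv i).trans (hw i).symm
  rw [Submodule.Quotient.eq] at h
  exact h

theorem existsUnique_isGrad (Φ : BL2dot) : ∃! G : BLdot3, IsGrad Φ G := by
  obtain ⟨φ, rfl⟩ := Submodule.Quotient.mk_surjective _ Φ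
  obtain ⟨v, hv⟩ := exists_hasWeakDeriv_of_mem_BL2 φ.2
  refine ⟨fun i => Submodule.Quotient.mk (v i), ⟨φ, v, rfl, represents_mk v, hv⟩, ?_⟩
  rintro G ⟨φ', w, hφ', hwG, hw⟩
  rw [Submodule.Quotient.eq] at hφ'
  obtain ⟨b, a, hab⟩ : ∃ (b : ℝ) (a : E3), ∀ᵐ x, (φ' - φ : E3 → ℝ) x = b + inner ℝ a x := hφ'
  funext i
  rw [← hwG i]
  have h1 : HasWeakDeriv i (φ' - φ : E3 → ℝ) (w i - v i : E3 → ℝ) := (hw i).sub (hv i)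
  have h2 : HasWeakDeriv i (φ' - φ : E3 → ℝ) (fun _ => a i) :=
    (hasWeakDeriv_affine b a i).congr (hab.mono fun x hx => hx.symm) EventuallyEq.rfl
  exact mk_eq_mk_of_ae (c := a i) (h1.ae_unique h2)

/-! ### Limits of solenoidal test fields -/

/-- `L₂` limits of gradients of solenoidal fields are trace-free. -/
theorem trace_eq_zero_of_tendsto {ψ : ℕ → Fin 3 → E3 → ℝ} (hψ : ∀ n, IsSolenoidalTest (ψ n))
    {z : Fin 3 → Fin 3 → E3 → ℝ} (hz : ∀ i j, MemLp (z i j) 2 volume)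
    (h : ∀ i j, Tendsto (fun n => eLpNorm (pd j (ψ n i) - z i j) 2 volume) atTop (𝓝 0)) :
    ∑ i, z i i =ᵐ[volume] 0 := by
  have hl : ∀ i j, LocallyIntegrable (z i j) := fun i j => locallyIntegrable_of_memLp_two (hz i j)
  refine ae_eq_of_integral_mul_test
    (locallyIntegrable_of_memLp_two (memLp_sum fun i => hz i i)) locallyIntegrable_zero
    fun χ hχ => ?_
  have hlim := tendsto_finsetSum Finset.univ fun i _ =>
    (TendstoL1loc.of_tendsto_eLpNorm (by norm_num)
      (fun n => (((hψ n).1 i).pd i).1.continuous.aestronglyMeasurable)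
      (hz i i).aestronglyMeasurable (h i i)).tendsto_integral
      (fun n => (((hψ n).1 i).pd i).1.continuous.locallyIntegrable) (hl i i) hχ
  rw [integral_sum_mul (fun i => hl i i) hχ]
  have h0 : ∀ n, ∑ i, ∫ x, pd i (ψ n i) x * χ x = 0 := by
    intro n
    rw [← integral_sum_mul
      (fun i => (((hψ n).1 i).pd i).1.continuous.locallyIntegrable) hχ]
    simp [Finset.sum_apply, (hψ n).2]
  simp only [h0] at hlim
  rw [tendsto_nhds_unique hlim tendsto_const_nhds]
  simp

theorem norm_curl_le (ψ : Fin 3 → E3 → ℝ) (x : E3) :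
    ‖curl ψ x‖ ≤ ∑ i, ∑ j, ‖pd j (ψ i) x‖ := by
  have h1 : ‖curl ψ x‖ ≤ ∑ k, ‖curl ψ x k‖ := by
    have hv : curl ψ x = ∑ k, curl ψ x k • EuclideanSpace.single k (1 : ℝ) := by
      ext k
      fin_cases k <;> simp [Fin.sum_univ_three]
    conv_lhs => rw [hv]
    refine (norm_sum_le _ _).trans (Finset.sum_le_sum fun k _ => ?_)
    simp [norm_smul]
  refine h1.trans ?_
  have e0 : ‖curl ψ x 0‖ ≤ ‖pd 1 (ψ 2) x‖ + ‖pd 2 (ψ 1) x‖ := norm_sub_le _ _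
  have e1 : ‖curl ψ x 1‖ ≤ ‖pd 2 (ψ 0) x‖ + ‖pd 0 (ψ 2) x‖ := norm_sub_le _ _
  have e2 : ‖curl ψ x 2‖ ≤ ‖pd 0 (ψ 1) x‖ + ‖pd 1 (ψ 0) x‖ := norm_sub_le _ _
  simp only [Fin.sum_univ_three]
  linarith [norm_nonneg (pd 0 (ψ 0) x), norm_nonneg (pd 1 (ψ 1) x), norm_nonneg (pd 2 (ψ 2) x)]

theorem curlNorm_le {ψ : Fin 3 → E3 → ℝ} (hψ : ∀ i, IsTest (ψ i)) :
    curlNorm ψ ≤ ∑ i, ∑ j, eLpNorm (pd j (ψ i)) 2 volume := by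
  have hm : ∀ i j, AEStronglyMeasurable (fun x => ‖pd j (ψ i) x‖) volume := fun i j =>
    ((hψ i).pd j).1.continuous.norm.aestronglyMeasurable
  have h1 : curlNorm ψ ≤ eLpNorm (∑ i, ∑ j, fun x => ‖pd j (ψ i) x‖) 2 volume := by
    refine eLpNorm_mono fun x => ?_
    simp only [Finset.sum_apply]
    rw [Real.norm_of_nonneg
      (Finset.sum_nonneg fun i _ => Finset.sum_nonneg fun j _ => norm_nonneg _)]
    exact norm_curl_le ψ x
  refine h1.trans ((eLpNorm_sum_le (fun i _ => Finset.aestronglyMeasurable_sum _ fun j _ => hm i j)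
    (by norm_num)).trans (Finset.sum_le_sum fun i _ => ?_))
  refine (eLpNorm_sum_le (fun j _ => hm i j) (by norm_num)).trans ?_
  simp only [eLpNorm_norm, le_refl]

theorem curlCauchy_of_tendsto_pd {ψ : ℕ → Fin 3 → E3 → ℝ} (hψ : ∀ n i, IsTest (ψ n i))
    {z : Fin 3 → Fin 3 → E3 → ℝ} (hz : ∀ i j, MemLp (z i j) 2 volume)
    (h : ∀ i j, Tendsto (fun n => eLpNorm (pd j (ψ n i) - z i j) 2 volume) atTop (𝓝 0)) :
    CurlCauchy ψ := by
  have h1 : Tendsto (fun q : ℕ × ℕ =>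
      ∑ i, ∑ j, eLpNorm (pd j (ψ q.1 i) - pd j (ψ q.2 i)) 2 volume) atTop (𝓝 0) := by
    have h2 := tendsto_finsetSum Finset.univ fun i (_ : i ∈ Finset.univ) =>
      tendsto_finsetSum Finset.univ fun j _ => cauchy_of_tendsto_eLpNorm (by norm_num)
        (fun n => ((hψ n i).pd j).1.continuous.aestronglyMeasurable)
        (hz i j).aestronglyMeasurable (h i j)
    simpa using h2
  refine tendsto_of_tendsto_of_tendsto_of_le_of_le tendsto_const_nhds h1 (fun _ => bot_le) ?_
  intro q
  have := curlNorm_le (ψ := ψ q.1 - ψ q.2) fun i => (hψ q.1 i).sub (hψ q.2 i)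
  simpa only [Pi.sub_apply, pd_sub (hψ _ _) (hψ _ _)] using this

theorem divFree_of_mem_BLC {U : BLdot3} (h : U ∈ BLC) : DivFree U := by
  obtain ⟨ψ, hψ, -, v, D, hv, hD⟩ := h
  refine ⟨v, hv, fun χ hχ => ?_⟩
  have h0 := trace_eq_zero_of_tendsto hψ (fun i j => (hD i j).1) fun i j => (hD i j).2.2
  have e : ∀ i, ∫ x, (v i : E3 → ℝ) x * pd i χ x = -∫ x, D i i x * χ x := fun i =>
    (hD i i).2.1.2.2 χ hχ
  simp only [e, Finset.sum_neg_distrib]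
  rw [← integral_sum_mul (fun i => (hD i i).2.1.2.1) hχ, integral_eq_zero_of_ae, neg_zero]
  filter_upwards [h0] with x hx
  rw [hx]; simp

/-! ### The direct sum decomposition -/

/-- The sum is everything: the gradient of `u` is projected onto the closure of the Hessians of
test functions, then the remainder onto the closure of the gradients of solenoidal test fields.
What is left is harmonic, hence zero. -/
theorem exists_add_mem_gradBL2_mem_BLC (U : BLdot3) :
    ∃ G ∈ gradBL2, ∃ V ∈ BLC, G + V = U := by
  choose u hu using fun i => Submodule.Quotient.mk_surjective _ (U i)
  choose d hd hdw using fun i => (u i).2.2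
  obtain ⟨χ, z, hχ, hz, hzl, hzo⟩ := exists_hessian_decomposition hd
  obtain ⟨φ, v, hφ, hv, hφv, hvz⟩ := exists_limit_of_tendsto_hessian hχ hz hzl
  have hs : ∀ i j, MemLp (d i j - z i j) 2 volume := fun i j => (hd i j).sub (hz i j)
  obtain ⟨ψ, y, hψ, hy, hyl, hyo⟩ := exists_solenoidal_decomposition hs
  choose V hV6 _ hVw using fun i => exists_limit_of_tendsto_pd (fun n => (hψ n).1 i) (hy i) (hyl i)
  have hsw : ∀ i j, HasWeakDeriv j ((u i : E3 → ℝ) - v i) (d i j - z i j) := fun i j =>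
    (hdw i j).sub (hvz i j)
  set r : Fin 3 → Fin 3 → E3 → ℝ := fun i j => d i j - z i j - y i j with hr
  have hrw : ∀ i j, HasWeakDeriv j ((u i : E3 → ℝ) - v i - V i) (r i j) := fun i j =>
    (hsw i j).sub (hVw i j)
  have hrL : ∀ i j, MemLp (r i j) 2 volume := fun i j => (hs i j).sub (hy i j)
  have hrc := rowCurlFree_of_hasWeakDeriv hrw
  have hrt : ∑ i, r i i =ᵐ[volume] 0 := by
    have h1 := (rowCurlFree_of_hasWeakDeriv hsw).trace_eq_zero hs hzo
    have h2 := trace_eq_zero_of_tendsto hψ hy hyl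
    filter_upwards [h1, h2] with x hx1 hx2
    have e : ∑ i, r i i = ∑ i, (d i i - z i i) - ∑ i, y i i := by
      rw [← Finset.sum_sub_distrib]
    rw [e, Pi.sub_apply, hx1, hx2]; simp
  have hr0 := hrc.eq_zero_of_symm_of_trace hrL (hrc.symm_of_orthogonal hrL hyo) hrt
  have hconst : ∀ i, ∃ c : ℝ, ∀ᵐ x, ((u i : E3 → ℝ) - v i - V i) x = c := fun i =>
    ae_const_of_hasWeakDeriv_zero fun j => (hrw i j).congr EventuallyEq.rfl (hr0 i j)
  -- `u - v - V` is a.e. constant, so `[u] = [v] + [V]`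
  let φ' : BL2 := ⟨φ, hφ, fun i j =>
    ⟨z i j, hz i j, HasWeakDeriv2.of_hasWeakDeriv (hφv i) (hvz i j)⟩⟩
  let v' : Fin 3 → BL := fun i => ⟨v i, hv i, fun j => ⟨z i j, hz i j, hvz i j⟩⟩
  let V' : Fin 3 → BL := fun i =>
    ⟨V i, MemL2loc.of_memLp (by norm_num) (hV6 i), fun j => ⟨y i j, hy i j, hVw i j⟩⟩
  refine ⟨fun i => Submodule.Quotient.mk (v' i),
    ⟨Submodule.Quotient.mk φ', φ', v', rfl, represents_mk v', hφv⟩,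
    fun i => Submodule.Quotient.mk (V' i),
    ⟨ψ, hψ, curlCauchy_of_tendsto_pd (fun n i => (hψ n).1 i) hy hyl, V', y, represents_mk V',
      fun i j => ⟨hy i j, hVw i j, hyl i j⟩⟩, ?_⟩
  funext i
  obtain ⟨c, hc⟩ := hconst i
  rw [← hu i, Pi.add_apply, ← Submodule.Quotient.mk_add]
  refine (mk_eq_mk_of_ae (c := c) ?_).symm
  filter_upwards [hc] with x hx
  rw [← hx]
  simp only [v', V', Submodule.coe_add, Pi.add_apply, Pi.sub_apply]
  ring

theorem tendsto_integral_mul_of_memLp_two {f : ℕ → E3 → ℝ} {F g : E3 → ℝ}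
    (hf : ∀ n, MemLp (f n) 2 volume) (hF : MemLp F 2 volume) (hg : MemLp g 2 volume)
    (h : Tendsto (fun n => eLpNorm (f n - F) 2 volume) atTop (𝓝 0)) :
    Tendsto (fun n => ∫ x, f n x * g x) atTop (𝓝 (∫ x, F x * g x)) := by
  have e : ∀ {f : E3 → ℝ} (hf : MemLp f 2 volume),
      inner ℝ (hg.toLp g) (hf.toLp f) = ∫ x, f x * g x := by
    intro f hf
    rw [L2.inner_def]
    refine integral_congr_ae ?_
    filter_upwards [hf.coeFn_toLp, hg.coeFn_toLp] with x h1 h2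
    simp [h1, h2]
  have h1 := (Lp.tendsto_Lp_iff_tendsto_eLpNorm'' f hf F hF).2 h
  have h2 := (tendsto_const_nhds (x := hg.toLp g)).inner (𝕜 := ℝ) h1
  simpa only [e] using h2

/-- The sum is direct: if `∇φ` is a limit of solenoidal test fields `ψₙ`, then its gradient `D`
is symmetric, and `∫ ∇ψₙ : D = ∫ ∇ψₙ : Dᵀ = 0` since `ψₙ` is divergence free; so `∫ |D|² = 0`. -/
theorem disjoint_gradBL2_BLC : Disjoint gradBL2 BLC := by
  rw [Submodule.disjoint_def]
  rintro U ⟨Φ, φ, w, -, hwU, hφw⟩ ⟨ψ, hψ, -, v, D, hvU, hD⟩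
  have hDL := fun i j => (hD i j).1
  have hwD : ∀ i j, HasWeakDeriv j (w i : E3 → ℝ) (D i j) := by
    intro i j
    obtain ⟨c, hc⟩ := hwU.ae_sub_const hvU i
    have h1 := ((hD i j).2.1.add (hasWeakDeriv_const c j))
    rw [add_zero] at h1
    refine h1.congr ?_ EventuallyEq.rfl
    filter_upwards [hc] with x hx
    rw [Pi.add_apply, ← hx]; ring
  have hsymm : ∀ i j, D i j =ᵐ[volume] D j i := fun i j =>
    ae_eq_of_integral_mul_test (hwD i j).2.1 (hwD j i).2.1 fun χ hχ => by
      have h1 := (HasWeakDeriv2.of_hasWeakDeriv (hφw i) (hwD i j)).2.2 χ hχ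
      have h2 := (HasWeakDeriv2.of_hasWeakDeriv (hφw j) (hwD j i)).2.2 χ hχ
      rw [← h1, ← h2, pd_comm hχ.1]
  have hzero : ∀ n, ∑ i, ∑ j, ∫ x, pd j (ψ n i) x * D i j x = 0 := by
    intro n
    have h1 : ∀ i j, ∫ x, pd j (ψ n i) x * D i j x
        = -∫ x, (w j : E3 → ℝ) x * pd j (pd i (ψ n i)) x := by
      intro i j
      rw [pd_comm ((hψ n).1 i).1, (hwD j i).2.2 _ (((hψ n).1 i).pd j), neg_neg]
      refine integral_congr_ae ?_
      filter_upwards [hsymm i j] with x hx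
      rw [hx, mul_comm]
    simp only [h1]
    rw [Finset.sum_comm]
    refine Finset.sum_eq_zero fun j _ => ?_
    have hdiv : ∑ i, pd i (ψ n i) = 0 := by
      funext x
      simpa using (hψ n).2 x
    rw [Finset.sum_neg_distrib, ← integral_finsetSum _ fun i _ =>
      integrable_mul_test (hwD j 0).1 ((((hψ n).1 i).pd i).pd j)]
    simp only [← Finset.mul_sum, ← Finset.sum_apply]
    rw [← pd_sum _ fun i => ((hψ n).1 i).pd i, hdiv, pd_zero]
    simp
  have hlim := tendsto_finsetSum Finset.univ fun i (_ : i ∈ Finset.univ) =>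
    tendsto_finsetSum Finset.univ fun j _ =>
      tendsto_integral_mul_of_memLp_two (fun n => (((hψ n).1 i).pd j).memLp 2) (hDL i j) (hDL i j)
        (hD i j).2.2
  simp only [hzero] at hlim
  have hsum := tendsto_nhds_unique hlim tendsto_const_nhds
  have hn : ∀ i j, 0 ≤ ∫ x, D i j x * D i j x := fun i j =>
    integral_nonneg fun x => mul_self_nonneg _
  have hD0 : ∀ i j, D i j =ᵐ[volume] 0 := by
    intro i j
    have h1 := (Finset.sum_eq_zero_iff_of_nonneg
      (fun i _ => Finset.sum_nonneg fun j _ => hn i j)).1 hsum i (Finset.mem_univ i)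
    have h2 := (Finset.sum_eq_zero_iff_of_nonneg (fun j _ => hn i j)).1 h1 j (Finset.mem_univ j)
    have hi : Integrable (fun x => D i j x * D i j x) := by
      simpa only [← sq] using (hDL i j).integrable_sq
    rw [integral_eq_zero_iff_of_nonneg (fun x => mul_self_nonneg _) hi] at h2
    filter_upwards [h2] with x hx
    simpa using hx
  funext i
  obtain ⟨c, hc⟩ := ae_const_of_hasWeakDeriv_zero fun j =>
    (hD i j).2.1.congr EventuallyEq.rfl (hD0 i j)
  rw [← hvU i, Pi.zero_apply, Submodule.Quotient.mk_eq_zero]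
  exact ⟨c, hc⟩

theorem isCompl_gradBL2_BLC : IsCompl gradBL2 BLC := by
  refine ⟨disjoint_gradBL2_BLC, ?_⟩
  rw [codisjoint_iff, Submodule.eq_top_iff']
  intro U
  obtain ⟨G, hG, V, hV, h⟩ := exists_add_mem_gradBL2_mem_BLC U
  exact Submodule.mem_sup.2 ⟨G, hG, V, hV, h⟩

end BeppoLevi

theorem mainTheorem4 :
    -- the gradient is a well-defined map from `BL²(ℝ³)/P` to `BL(ℝ³)³` modulo constants
    (∀ Φ : BeppoLevi.BL2dot, ∃! G : BeppoLevi.BLdot3, BeppoLevi.IsGrad Φ G) ∧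
    -- the decomposition `u = ∇φ + u*` with `div u* = 0`
    (∀ U : BeppoLevi.BLdot3, ∃ (Φ : BeppoLevi.BL2dot) (G V : BeppoLevi.BLdot3),
      BeppoLevi.IsGrad Φ G ∧ BeppoLevi.DivFree V ∧ U = G + V) ∧
    -- the direct sum `BL(ℝ³)³ = ∇(BL²(ℝ³)) ⊕ BLC(ℝ³)`, everything modulo constants
    IsCompl BeppoLevi.gradBL2 BeppoLevi.BLC := by
  refine ⟨BeppoLevi.existsUnique_isGrad, fun U => ?_, BeppoLevi.isCompl_gradBL2_BLC⟩
  obtain ⟨G, ⟨Φ, hΦ⟩, V, hV, h⟩ := BeppoLevi.exists_add_mem_gradBL2_mem_BLC U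
  exact ⟨Φ, G, V, hΦ, BeppoLevi.divFree_of_mem_BLC hV, h.symm⟩
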